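/- For $n\ge 1$ let $\Sigma_n$ be the symmetric group on the letters $1,\dots,n$ and let $J_n$ be the quasi-braid group: it has one generator $\alpha_T$ for each interval $T=[i,j]$, $1\le i<j\le n$ (equivalently, for each nonempty connected set $\{\sigma_i,\dots,\sigma_{j-1}\}$ of Coxeter generators of $\Sigma_n$), subject to the relations $\alpha_T^2=1$ for all $T$; $\alpha_T\alpha_{T'}=\alpha_{j_TT'}\alpha_T$ if $T'\subset T$, where $j_TT'$ is the mirror image of $T'$ inside $T$; and $\alpha_T\alpha_{T'}=\alpha_{T'}\alpha_T$ if $T$ and $T'$ are disjoint. Let $\phi:J_n\to\Sigma_n$ be the homomorphism that sends $\alpha_{[i,j]}$ to the involution reversing the order of $i,i+1,\dots,j$ and fixing the other letters. The dyadic expansion is the homomorphism $\exp:J_n\to J_{2n}$ with $\exp(\alpha_{[i,j]})=\alpha_{[2i-1,2j]}\,\alpha_{[2i-1,2i]}\,\alpha_{[2i+1,2i+2]}\cdots\alpha_{[2j-1,2j]}$, and $J_{2^\infty}=\varinjlim_k J_{2^k}$ along these homomorphisms. For $\sigma\in\Sigma_{2^k}$ and $\tau\in\Sigma_{2^l}$,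 let $\sigma(\tau,\dots,\tau)\in\Sigma_{2^{k+l}}$ be the wreath product, which permutes the $2^k$ consecutive blocks of $2^l$ letters by $\sigma$ and the letters inside each block by $\tau$. $B$ denotes the classifying space functor (the geometric realization of the nerve of a discrete group). Then there are group homomorphisms $\mu_{k,l}:J_{2^k}\times J_{2^l}\to J_{2^{k+l}}$, $k,l\ge 0$, with the following properties. 1. They lift the homomorphisms $\Sigma_{2^k}\times\Sigma_{2^l}\to\Sigma_{2^{k+l}}$, $(\sigma,\tau)\mapsto\sigma(\tau,\dots,\tau)$, that is, $\phi(\mu_{k,l}(a,b))=\phi(a)(\phi(b),\dots,\phi(b))$. Moreover $\mu_{k,l}(a,1)=\exp^l(a)$, and $\mu_{k,l}(1,\alpha_T)=\alpha_{T_1}\alpha_{T_2}\cdots\alpha_{T_{2^k}}$ for every generator $\alpha_T$ of $J_{2^l}$, where $T_i$ is the copy of $T$ in the $i$-th block of $2^l$ letters. 2. The maps $BJ_{2^k}\times BJ_{2^l}\cong B(J_{2^k}\times J_{2^l})\xrightarrow{B\mu_{k,l}}BJ_{2^{k+l}}$ make the disjoint union $M_J=\coprod_{k\in\mathbb N}BJ_{2^k}$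 a topological monoid. 3. Let $(M_J)_\infty$ be the inductive limit (in topological spaces) of the telescope $M_J\to M_J\to M_J\to\cdots$ in which every map is right multiplication by the base point of $BJ_2$ (the point given by $1\in J_2$). There is a homeomorphism $(M_J)_\infty\cong\mathbb Z\times BJ_{2^\infty}$. It sends the class of a point $x\in BJ_{2^k}$ of the $i$-th copy of $M_J$ ($i=0,1,2,\dots$) to $(k-i,\iota_k(x))$, where $\iota_k:BJ_{2^k}\to BJ_{2^\infty}$ is induced by the canonical homomorphism $J_{2^k}\to J_{2^\infty}$. -/

import Mathlib

open CategoryTheory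

namespace QuasiBraid

/-- A nonempty set `T` of Coxeter generators `σ_i = (i, i+1)` of the symmetric group on the `n`
letters `0, …, n-1` whose Coxeter graph `G_T` is connected is `{σ_lo, …, σ_(hi-1)}` for a unique
interval `[lo, hi]` of at least two letters; it is recorded by that interval. -/
structure Interval (n : ℕ) where
  lo : ℕ
  hi : ℕ
  lo_lt_hi : lo < hi
  hi_lt : hi < n

namespace Interval

variable {n : ℕ}

/-- `T' ⊆ T`. -/
def Contains (T T' : Interval n) : Prop := T.lo ≤ T'.lo ∧ T'.hi ≤ T.hi

/-- `G_{T ∪ T'}` is not connected, i.e. the two intervals of letters are disjoint. -/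
def Separated (T T' : Interval n) : Prop := T.hi < T'.lo ∨ T'.hi < T.lo

/-- `j_T T' = ω_T T' ω_T` for `T' ⊆ T`: the mirror image of `T'` inside `T`. -/
def reflect (T T' : Interval n) (h : T.Contains T') : Interval n where
  lo := T.lo + T.hi - T'.hi
  hi := T.lo + T.hi - T'.lo
  lo_lt_hi := by
    have := T'.lo_lt_hi; have := h.1; have := h.2; omega
  hi_lt := by
    have := T'.lo_lt_hi; have := h.1; have := h.2; have := T.hi_lt; omega

/-- The underlying map of `ω_T`: it reverses the letters of `[lo, hi]` and fixes the others. -/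
def flip (T : Interval n) (x : Fin n) : Fin n :=
  if h : T.lo ≤ x.1 ∧ x.1 ≤ T.hi then
    ⟨T.lo + T.hi - x.1, by have := T.hi_lt; omega⟩
  else x

theorem flip_val (T : Interval n) (x : Fin n) :
    (T.flip x).1 = if T.lo ≤ x.1 ∧ x.1 ≤ T.hi then T.lo + T.hi - x.1 else x.1 := by
  unfold flip
  split_ifs <;> rfl

theorem flip_flip (T : Interval n) : Function.Involutive T.flip := by
  intro x
  apply Fin.ext
  rw [flip_val, flip_val]
  split_ifs <;> omega

/-- The involution `ω_T`, the longest element of the parabolic subgroup generated by `T`. -/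
def omega (T : Interval n) : Equiv.Perm (Fin n) := T.flip_flip.toPerm

end Interval

/-- The defining relations between the generators `α_T` of the quasi-braid group. -/
inductive Rel (n : ℕ) : FreeGroup (Interval n) → Prop
  | sq (T : Interval n) : Rel n (FreeGroup.of T ^ 2)
  | nested (T T' : Interval n) (h : T.Contains T') :
      Rel n (FreeGroup.of T * FreeGroup.of T' *
        (FreeGroup.of (T.reflect T' h) * FreeGroup.of T)⁻¹)
  | separated (T T' : Interval n) (h : T.Separated T') :
      Rel n (FreeGroup.of T * FreeGroup.of T' * (FreeGroup.of T' * FreeGroup.of T)⁻¹)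

/-- The quasi-braid group `J_n`. -/
abbrev J (n : ℕ) : Type := PresentedGroup {r | Rel n r}

/-- The generator `α_T` of `J_n`. -/
def alpha {n : ℕ} (T : Interval n) : J n := PresentedGroup.of T

theorem alpha_sq {n : ℕ} (T : Interval n) : alpha T * alpha T = 1 := by
  rw [← pow_two]
  exact PresentedGroup.one_of_mem (rels := {r | Rel n r}) (Rel.sq T)

theorem alpha_nested {n : ℕ} (T T' : Interval n) (h : T.Contains T') :
    alpha T * alpha T' = alpha (T.reflect T' h) * alpha T :=
  PresentedGroup.mk_eq_mk_of_mul_inv_mem (rels := {r | Rel n r}) (Rel.nested T T' h)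

theorem alpha_separated {n : ℕ} (T T' : Interval n) (h : T.Separated T') :
    alpha T * alpha T' = alpha T' * alpha T :=
  PresentedGroup.mk_eq_mk_of_mul_inv_mem (rels := {r | Rel n r}) (Rel.separated T T' h)

/-- A homomorphism out of `J_n` from images of the generators that satisfy the relations. -/
def J.lift {n : ℕ} {G : Type*} [Group G] (f : Interval n → G)
    (h1 : ∀ T, f T * f T = 1)
    (h2 : ∀ T T' (h : T.Contains T'), f T * f T' = f (T.reflect T' h) * f T)
    (h3 : ∀ T T', T.Separated T' → f T * f T' = f T' * f T) : J n →* G :=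
  PresentedGroup.toGroup (f := f) (rels := {r | Rel n r}) (by
    intro r hr
    cases hr with
    | sq T => simpa [pow_two] using h1 T
    | nested T T' h => rw [map_mul, map_inv, mul_inv_eq_one]; simpa using h2 T T' h
    | separated T T' h => rw [map_mul, map_inv, mul_inv_eq_one]; simpa using h3 T T' h)

@[simp] theorem J.lift_alpha {n : ℕ} {G : Type*} [Group G] (f : Interval n → G)
    (h1 : ∀ T, f T * f T = 1)
    (h2 : ∀ T T' (h : T.Contains T'), f T * f T' = f (T.reflect T' h) * f T)
    (h3 : ∀ T T', T.Separated T' → f T * f T' = f T' * f T) (T : Interval n) :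
    J.lift f h1 h2 h3 (alpha T) = f T :=
  PresentedGroup.toGroup.of _

/-- The projection `φ : J_n → Σ_n`, `α_T ↦ ω_T`. -/
def phi (n : ℕ) : J n →* Equiv.Perm (Fin n) :=
  J.lift Interval.omega
    (by
      intro T
      ext x
      exact congrArg Fin.val (T.flip_flip x))
    (by
      intro T T' h
      have h1 := h.1
      have h2 := h.2
      have h3 := T'.lo_lt_hi
      ext x
      change (T.flip (T'.flip x)).1 = ((T.reflect T' h).flip (T.flip x)).1
      simp only [Interval.flip_val, Interval.reflect]
      split_ifs <;> omega)
    (by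
      intro T T' h
      have h1 := T.lo_lt_hi
      have h2 := T'.lo_lt_hi
      unfold Interval.Separated at h
      ext x
      change (T.flip (T'.flip x)).1 = (T'.flip (T.flip x)).1
      simp only [Interval.flip_val]
      split_ifs <;> omega)

/-- The generator of `J_n` attached to the interval `[a, b]` of letters, where `a < b < n`
(and `1` otherwise). -/
def gen (n a b : ℕ) : J n :=
  if h : a < b ∧ b < n then alpha ⟨a, b, h.1, h.2⟩ else 1

theorem gen_sq (n a b : ℕ) : gen n a b * gen n a b = 1 := by
  unfold gen
  split_ifs
  · exact alpha_sq _
  · simp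

theorem gen_nested (n a b c d : ℕ) (hac : a ≤ c) (hcd : c < d) (hdb : d ≤ b) (hb : b < n) :
    gen n a b * gen n c d = gen n (a + b - d) (a + b - c) * gen n a b := by
  unfold gen
  rw [dif_pos ⟨by omega, hb⟩, dif_pos ⟨hcd, by omega⟩, dif_pos ⟨by omega, by omega⟩]
  exact alpha_nested _ _ ⟨hac, hdb⟩

theorem gen_separated (n a b c d : ℕ) (h : b < c ∨ d < a) :
    gen n a b * gen n c d = gen n c d * gen n a b := by
  unfold gen
  split_ifs
  · exact alpha_separated _ _ h
  all_goals simp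

/-- The product `α_{(2a,2a+1)} ⋯ α_{(2b,2b+1)}` of the flips of the pairs of letters that replace
the letters of `[a, b]`. -/
def pairs (n a b : ℕ) : J n :=
  ((List.range' a (b + 1 - a)).map fun i => gen n (2 * i) (2 * i + 1)).prod

theorem pairs_swap (n i j : ℕ) :
    Commute (gen n (2 * i) (2 * i + 1)) (gen n (2 * j) (2 * j + 1)) := by
  rcases lt_trichotomy i j with h | rfl | h
  · exact gen_separated _ _ _ _ _ (by omega)
  · exact Commute.refl _
  · exact gen_separated _ _ _ _ _ (by omega)

theorem pairs_commute (n a b c d : ℕ) : Commute (pairs n a b) (pairs n c d) := by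
  unfold pairs
  refine Commute.list_prod_left _ _ fun x hx => Commute.list_prod_right _ _ fun y hy => ?_
  obtain ⟨i, -, rfl⟩ := List.mem_map.1 hx
  obtain ⟨j, -, rfl⟩ := List.mem_map.1 hy
  exact pairs_swap n i j

theorem prod_map_sq {ι G : Type*} [Group G] (f : ι → G) (hf : ∀ i, f i * f i = 1)
    (hc : ∀ i j, Commute (f i) (f j)) (L : List ι) : (L.map f).prod * (L.map f).prod = 1 := by
  induction L with
  | nil => simp
  | cons i L ih =>
    have h : Commute (L.map f).prod (f i) := by
      refine Commute.list_prod_left _ _ fun x hx => ?_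
      obtain ⟨j, -, rfl⟩ := List.mem_map.1 hx
      exact hc j i
    rw [List.map_cons, List.prod_cons, mul_assoc, ← mul_assoc _ (f i), h.eq, mul_assoc, ih,
      mul_one, hf]

theorem pairs_sq (n a b : ℕ) : pairs n a b * pairs n a b = 1 :=
  prod_map_sq _ (fun _ => gen_sq _ _ _) (fun i j => pairs_swap n i j) _

theorem prod_map_conj {ι G : Type*} [Group G] (x : G) (f g : ι → G) (L : List ι)
    (h : ∀ i ∈ L, x * f i = g i * x) : x * (L.map f).prod = (L.map g).prod * x := by
  induction L with
  | nil => simp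
  | cons i L ih =>
    rw [List.map_cons, List.prod_cons, List.map_cons, List.prod_cons, ← mul_assoc,
      h i (by simp), mul_assoc, ih fun j hj => h j (by simp [hj]), mul_assoc]

/-- The flip of a doubled interval carries the pairs over `[c, d]` to the pairs over its mirror
image. -/
theorem gen_pairs_nested (n a b c d : ℕ) (hac : a ≤ c) (hcd : c ≤ d) (hdb : d ≤ b)
    (hb : 2 * b + 1 < n) :
    gen n (2 * a) (2 * b + 1) * pairs n c d =
      pairs n (a + b - d) (a + b - c) * gen n (2 * a) (2 * b + 1) := by
  unfold pairs
  rw [prod_map_conj (gen n (2 * a) (2 * b + 1)) _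
    (fun i => gen n (2 * (a + b - i)) (2 * (a + b - i) + 1)) _ (by
      intro i hi
      rw [List.mem_range'_1] at hi
      rw [gen_nested n (2 * a) (2 * b + 1) (2 * i) (2 * i + 1) (by omega) (by omega) (by omega) hb]
      congr 2 <;> omega)]
  congr 1
  have hperm : ((List.range' c (d + 1 - c)).map fun i => a + b - i).Perm
      (List.range' (a + b - d) (a + b - c + 1 - (a + b - d))) := by
    rw [List.perm_ext_iff_of_nodup]
    · intro x
      simp only [List.mem_map, List.mem_range'_1]
      constructor
      · rintro ⟨i, hi, rfl⟩
        omega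
      · intro hx
        exact ⟨a + b - x, by omega, by omega⟩
    · refine List.Nodup.map_on ?_ List.nodup_range'
      intro x hx y hy hxy
      rw [List.mem_range'_1] at hx hy
      omega
    · exact List.nodup_range'
  have h2 := hperm.map fun i => gen n (2 * i) (2 * i + 1)
  rw [List.map_map] at h2
  refine h2.prod_eq' ?_
  exact List.pairwise_map.2 (List.pairwise_of_forall fun i j => pairs_swap n _ _)

theorem pairs_gen_commute (n a b c d : ℕ)
    (h : b < c ∨ d < a) : pairs n a b * gen n (2 * c) (2 * d + 1) =
      gen n (2 * c) (2 * d + 1) * pairs n a b := by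
  have : Commute (pairs n a b) (gen n (2 * c) (2 * d + 1)) := by
    refine Commute.list_prod_left _ _ fun x hx => ?_
    obtain ⟨i, hi, rfl⟩ := List.mem_map.1 hx
    rw [List.mem_range'_1] at hi
    exact gen_separated _ _ _ _ _ (by omega)
  exact this

/-- The flip of the doubled interval `[2c, 2d+1]` commutes with all pairs over a larger interval. -/
theorem gen_pairs_commute_of_le (n a b c d : ℕ) (hac : a ≤ c) (hcd : c ≤ d) (hdb : d ≤ b)
    (hb : 2 * b + 1 < n) :
    Commute (gen n (2 * c) (2 * d + 1)) (pairs n a b) := by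
  have hsplit : pairs n a b =
      ((List.range' a (c - a)).map fun i => gen n (2 * i) (2 * i + 1)).prod * pairs n c d *
      ((List.range' (d + 1) (b - d)).map fun i => gen n (2 * i) (2 * i + 1)).prod := by
    unfold pairs
    rw [← List.prod_append, ← List.prod_append, ← List.map_append, ← List.map_append]
    have e1 : List.range' c (d + 1 - c) = List.range' (a + (c - a)) (d + 1 - c) := by
      congr 1; omega
    have e2 : List.range' (d + 1) (b - d) =
        List.range' (a + (c - a + (d + 1 - c))) (b - d) := by
      congr 1; omega
    rw [e1, List.range'_append_1, e2, List.range'_append_1]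
    congr 3
    omega
  have hout : ∀ s m, s + m ≤ c ∨ d + 1 ≤ s → Commute (gen n (2 * c) (2 * d + 1))
      ((List.range' s m).map fun i => gen n (2 * i) (2 * i + 1)).prod := by
    intro s m hs
    refine Commute.list_prod_right _ _ fun x hx => ?_
    obtain ⟨i, hi, rfl⟩ := List.mem_map.1 hx
    rw [List.mem_range'_1] at hi
    exact gen_separated _ _ _ _ _ (by omega)
  have hin : Commute (gen n (2 * c) (2 * d + 1)) (pairs n c d) := by
    have h := gen_pairs_nested n c d c d le_rfl hcd le_rfl (by omega)
    have e1 : c + d - d = c := by omega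
    have e2 : c + d - c = d := by omega
    rw [e1, e2] at h
    exact h
  rw [hsplit]
  exact ((hout _ _ (by omega)).mul_right hin).mul_right (hout _ _ (by omega))

/-- The dyadic expansion `exp : J_n → J_{2n}`,
`α_{[a,b]} ↦ α_{[2a,2b+1]} α_{(2a,2a+1)} ⋯ α_{(2b,2b+1)}`: every letter `i` is replaced by the two
letters `2i, 2i+1`. -/
def expand (n N : ℕ) (hN : N = 2 * n) : J n →* J N :=
  J.lift (fun T => gen N (2 * T.lo) (2 * T.hi + 1) * pairs N T.lo T.hi)
    (by
      intro T
      have h1 := T.lo_lt_hi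
      have h2 := T.hi_lt
      have hc := gen_pairs_commute_of_le N T.lo T.hi T.lo T.hi le_rfl (by omega) le_rfl (by omega)
      rw [mul_assoc, ← mul_assoc (pairs _ _ _), ← hc.eq, mul_assoc, pairs_sq, mul_one, gen_sq])
    (by
      intro T T' h
      have h1 := T'.lo_lt_hi
      have h2 := T.hi_lt
      have h3 := h.1
      have h4 := h.2
      have hc := gen_pairs_commute_of_le N T.lo T.hi T'.lo T'.hi h3 (by omega) h4 (by omega)
      have hn := gen_nested N (2 * T.lo) (2 * T.hi + 1) (2 * T'.lo) (2 * T'.hi + 1)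
        (by omega) (by omega) (by omega) (by omega)
      have hp := gen_pairs_nested N T.lo T.hi T'.lo T'.hi h3 (by omega) h4 (by omega)
      have e1 : 2 * T.lo + (2 * T.hi + 1) - (2 * T'.hi + 1) = 2 * (T.lo + T.hi - T'.hi) := by omega
      have e2 : 2 * T.lo + (2 * T.hi + 1) - 2 * T'.lo = 2 * (T.lo + T.hi - T'.lo) + 1 := by omega
      rw [e1, e2] at hn
      dsimp only [Interval.reflect]
      rw [mul_assoc, ← mul_assoc (pairs _ _ _), ← hc.eq, mul_assoc (gen _ (2 * T'.lo) _),
        ← mul_assoc, hn, (pairs_commute N T.lo T.hi T'.lo T'.hi).eq, mul_assoc,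
        ← mul_assoc (gen _ (2 * T.lo) _) (pairs _ _ _), hp]
      simp only [mul_assoc])
    (by
      intro T T' h
      have h1 := T.lo_lt_hi
      have h2 := T'.lo_lt_hi
      have h3 := T.hi_lt
      have h4 := T'.hi_lt
      unfold Interval.Separated at h
      have c1 : Commute (gen N (2 * T.lo) (2 * T.hi + 1)) (gen N (2 * T'.lo) (2 * T'.hi + 1)) :=
        gen_separated _ _ _ _ _ (by omega)
      have c2 : Commute (pairs N T.lo T.hi) (gen N (2 * T'.lo) (2 * T'.hi + 1)) :=
        pairs_gen_commute N _ _ _ _ (by omega)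
      have c3 : Commute (pairs N T'.lo T'.hi) (gen N (2 * T.lo) (2 * T.hi + 1)) :=
        pairs_gen_commute N _ _ _ _ (by omega)
      have c4 := pairs_commute N T.lo T.hi T'.lo T'.hi
      exact (c1.mul_left c2).mul_right (c3.symm.mul_left c4))

/-- The bijection `(i, a) ↦ i * 2^l + a`, which divides the `2^(k+l)` letters into `2^k`
consecutive blocks of `2^l` letters. -/
def blocks (k l : ℕ) : Fin (2 ^ k) × Fin (2 ^ l) ≃ Fin (2 ^ (k + l)) :=
  finProdFinEquiv.trans (finCongr (pow_add 2 k l).symm)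

theorem blocks_val (k l : ℕ) (x : Fin (2 ^ k) × Fin (2 ^ l)) :
    (blocks k l x : ℕ) = x.1 * 2 ^ l + x.2 := by
  simp [blocks, finProdFinEquiv]
  ring

/-- The wreath product `(σ, τ) ↦ σ(τ, …, τ)`: it permutes the `2^k` blocks of `2^l` letters by `σ`
and the letters inside every block by `τ`. -/
def wreath (k l : ℕ) :
    Equiv.Perm (Fin (2 ^ k)) × Equiv.Perm (Fin (2 ^ l)) →* Equiv.Perm (Fin (2 ^ (k + l))) where
  toFun p := (blocks k l).permCongr (Equiv.prodCongr p.1 p.2)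
  map_one' := by ext x; simp [Equiv.permCongr_apply]
  map_mul' p q := by
    ext x
    simp [Equiv.permCongr_apply, Prod.map]

/-- The dyadic expansion `exp : J_{2^k} → J_{2^(k+1)}`. -/
def expTwo (k : ℕ) : J (2 ^ k) →* J (2 ^ (k + 1)) :=
  expand (2 ^ k) (2 ^ (k + 1)) (pow_succ' 2 k)

/-- The iterated dyadic expansion `exp^l : J_{2^k} → J_{2^(k+l)}`. -/
def expIter (k : ℕ) : (l : ℕ) → J (2 ^ k) →* J (2 ^ (k + l))
  | 0 => MonoidHom.id _
  | l + 1 => (expTwo (k + l)).comp (expIter k l)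

/-- The sequence `J_{2^0} → J_{2^1} → J_{2^2} → ⋯` of dyadic expansions. -/
def sequenceJ : ℕ ⥤ GrpCat.{0} :=
  Functor.ofSequence (X := fun k => GrpCat.of (J (2 ^ k))) fun k => GrpCat.ofHom (expTwo k)

/-- `J_{2^∞}`, the inductive limit of the groups `J_{2^k}` along the dyadic expansions. -/
noncomputable def Jinf : GrpCat.{0} := (GrpCat.FilteredColimits.colimitCocone sequenceJ).pt

/-- The canonical homomorphism `J_{2^k} → J_{2^∞}`. -/
noncomputable def toJinf (k : ℕ) : GrpCat.of (J (2 ^ k)) ⟶ Jinf :=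
  (GrpCat.FilteredColimits.colimitCocone sequenceJ).ι.app k

/-- The classifying space functor `B`: the geometric realization of the nerve of a (discrete)
group, viewed as a category with one object. -/
noncomputable def B : GrpCat.{0} ⥤ TopCat.{0} :=
  forget₂ GrpCat MonCat ⋙ MonCat.toCat ⋙ nerveFunctor ⋙ SSet.toTop

/-- The base point of `BG`: the vertex given by the unique object of the one-object category. -/
noncomputable def basePoint (G : GrpCat.{0}) : B.obj G :=
  TopCat.toSSetObj₀Equiv ((sSetTopAdj.unit.app (nerve (SingleObj G))).app _
    (nerveEquiv.symm (SingleObj.star G)))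

/-- The space `M_J = ∐_k BJ_{2^k}`, with the topology of the disjoint union. -/
abbrev MJ : Type := Σ k : ℕ, B.obj (GrpCat.of (J (2 ^ k)))

/-- The point of `M_J` given by the base point of `BJ_2`, i.e. by `1 ∈ J_2`. -/
noncomputable def idTwo : MJ := ⟨1, basePoint _⟩

/-- The telescope `M → M → M → ⋯` of right multiplications by an element `p` of a topological
monoid `M`. -/
def telescope (M : Type) [TopologicalSpace M] [Monoid M] [ContinuousMul M] (p : M) :
    ℕ ⥤ TopCat.{0} :=
  Functor.ofSequence (X := fun _ => TopCat.of M) fun _ =>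
    TopCat.ofHom ⟨fun x => x * p, continuous_mul_const p⟩

end QuasiBraid

/-- A countable family of compact Hausdorff charts whose images cover `X`, determine its topology,
and whose overlaps are closed. -/
structure IsCompactAtlas {ι X : Type*} {D : ι → Type*} [∀ i, TopologicalSpace (D i)]
    [TopologicalSpace X] (c : ∀ i, D i → X) : Prop where
  continuous : ∀ i, Continuous (c i)
  cover : ∀ x, ∃ i s, c i s = x
  isOpen : ∀ U : Set X, (∀ i, IsOpen (c i ⁻¹' U)) → IsOpen U
  isClosed_overlap : ∀ i j, IsClosed {p : D i × D j | c i p.1 = c j p.2}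

namespace IsCompactAtlas

theorem isOpen_iUnion_of_charts {ι X : Type*} {D : ι → Type*} [∀ i, TopologicalSpace (D i)]
    [TopologicalSpace X] {c : ∀ i, D i → X} (h : IsCompactAtlas c) (f : ι → ℕ) (A O : ℕ → Set X)
    (hO : ∀ n, IsOpen (O n)) (hAO : ∀ n, A n ⊆ O n) (hA : Monotone A)
    (hOA : ∀ n i, f i ≤ n → ∀ s, c i s ∈ O n → c i s ∈ A (n + 1)) : IsOpen (⋃ n, A n) := by
  refine h.isOpen _ fun i => ?_
  have : c i ⁻¹' (⋃ n, A n) = ⋃ n, c i ⁻¹' O (n + f i) := by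
    ext s
    simp only [Set.mem_preimage, Set.mem_iUnion]
    constructor
    · rintro ⟨n, hn⟩
      exact ⟨n, hAO _ (hA (by omega) hn)⟩
    · rintro ⟨n, hn⟩
      exact ⟨_, hOA _ i (by omega) s hn⟩
  rw [this]
  exact isOpen_iUnion fun n => (hO _).preimage (h.continuous i)

variable {ι X : Type*} {D : ι → Type*} [∀ i, TopologicalSpace (D i)] [∀ i, CompactSpace (D i)]
  [TopologicalSpace X] {c : ∀ i, D i → X}

theorem isClosedMap (h : IsCompactAtlas c) (i : ι) : IsClosedMap (c i) := by
  intro C hC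
  rw [← isOpen_compl_iff]
  refine h.isOpen _ fun j => ?_
  rw [Set.preimage_compl, isOpen_compl_iff]
  have h1 : IsClosed ({p : D i × D j | c i p.1 = c j p.2} ∩ Prod.fst ⁻¹' C) :=
    (h.isClosed_overlap i j).inter (hC.preimage continuous_fst)
  convert isClosedMap_snd_of_compactSpace _ h1 using 1
  ext t
  simp only [Set.mem_preimage, Set.mem_image, Set.mem_inter_iff, Set.mem_ofPred_eq, Prod.exists,
    exists_eq_right]
  exact exists_congr fun s => and_comm

theorem isClosedMap_sigma (h : IsCompactAtlas c) (S : Set ι) [Finite S] :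
    IsClosedMap fun x : Σ i : S, D i => c x.1 x.2 := by
  intro C hC
  have : (fun x : Σ i : S, D i => c x.1 x.2) '' C =
      ⋃ i : S, c i '' (Sigma.mk (β := fun i : S => D i) i ⁻¹' C) := by
    ext y
    simp only [Set.mem_image, Sigma.exists, Set.mem_iUnion, Set.mem_preimage]
  rw [this]
  exact isClosed_iUnion_of_finite fun i =>
    h.isClosedMap i _ (hC.preimage continuous_sigmaMk)

variable [∀ i, T2Space (D i)]

theorem isClosed_singleton (h : IsCompactAtlas c) (x : X) : IsClosed {x} := by
  obtain ⟨i, s, rfl⟩ := h.cover x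
  simpa using h.isClosedMap i _ (_root_.isClosed_singleton (x := s))

variable {κ Y : Type*} {E : κ → Type*} [∀ i, TopologicalSpace (E i)] [∀ i, CompactSpace (E i)]
  [∀ i, T2Space (E i)] [TopologicalSpace Y] {e : ∀ i, E i → Y}

/-- Inside finitely many charts, a closed rectangle in a set that is open in the charts has a
larger closed rectangle as a neighbourhood. -/
theorem exists_rectangle (h : IsCompactAtlas c) (h' : IsCompactAtlas e) {W : Set (X × Y)}
    (hW : ∀ i j, IsOpen (Prod.map (c i) (e j) ⁻¹' W)) (S : Set ι) (hS : S.Finite)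
    (S' : Set κ) (hS' : S'.Finite) (A : Set X) (hA : IsClosed A) (B : Set Y) (hB : IsClosed B)
    (hAB : A ×ˢ B ⊆ W) :
    ∃ (O A' : Set X) (O' B' : Set Y), IsOpen O ∧ IsOpen O' ∧ IsClosed A' ∧ IsClosed B' ∧
      A ⊆ O ∧ B ⊆ O' ∧ A' ×ˢ B' ⊆ W ∧ (∀ i ∈ S, ∀ s, c i s ∈ O → c i s ∈ A') ∧
      (∀ i ∈ S', ∀ s, e i s ∈ O' → e i s ∈ B') := by
  have := hS.to_subtype
  have := hS'.to_subtype
  let p : (Σ i : S, D i) → X := fun x => c x.1 x.2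
  let q : (Σ i : S', E i) → Y := fun x => e x.1 x.2
  have hp : Continuous p := continuous_sigma fun i => h.continuous i
  have hq : Continuous q := continuous_sigma fun i => h'.continuous i
  have hpc : IsClosedMap p := h.isClosedMap_sigma S
  have hqc : IsClosedMap q := h'.isClosedMap_sigma S'
  have hopen : IsOpen (Prod.map p q ⁻¹' W) := by
    rw [isOpen_iff_mem_nhds]
    rintro ⟨⟨i, s⟩, ⟨j, t⟩⟩ hst
    have h1 : Prod.map (c i) (e j) ⁻¹' W ∈ nhds (s, t) := (hW i j).mem_nhds hst
    rw [nhds_prod_eq, Sigma.nhds_mk, Sigma.nhds_mk, Filter.prod_map_map_eq, ← nhds_prod_eq]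
    exact h1
  obtain ⟨U, V, hU, hV, hAU, hBV, hUV⟩ := generalized_tube_lemma (hA.preimage hp).isCompact
    (hB.preimage hq).isCompact hopen (fun x hx => hAB ⟨hx.1, hx.2⟩)
  obtain ⟨U1, hU1, hAU1, hU1U⟩ := normal_exists_closure_subset (hA.preimage hp) hU hAU
  obtain ⟨V1, hV1, hBV1, hV1V⟩ := normal_exists_closure_subset (hB.preimage hq) hV hBV
  refine ⟨(p '' U1ᶜ)ᶜ, p '' closure U1, (q '' V1ᶜ)ᶜ, q '' closure V1,
    (hpc _ hU1.isClosed_compl).isOpen_compl, (hqc _ hV1.isClosed_compl).isOpen_compl,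
    hpc _ isClosed_closure, hqc _ isClosed_closure, ?_, ?_, ?_, ?_, ?_⟩
  · rintro x hx ⟨y, hy, rfl⟩
    exact hy (hAU1 hx)
  · rintro x hx ⟨y, hy, rfl⟩
    exact hy (hBV1 hx)
  · rintro ⟨_, _⟩ ⟨⟨x, hx, rfl⟩, ⟨y, hy, rfl⟩⟩
    exact hUV (Set.mk_mem_prod (hU1U hx) (hV1V hy))
  · intro i hi s hs
    refine ⟨⟨⟨i, hi⟩, s⟩, subset_closure ?_, rfl⟩
    by_contra hn
    exact hs ⟨_, hn, rfl⟩
  · intro i hi s hs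
    refine ⟨⟨⟨i, hi⟩, s⟩, subset_closure ?_, rfl⟩
    by_contra hn
    exact hs ⟨_, hn, rfl⟩

theorem isOpen_prod [Countable ι] [Countable κ] (h : IsCompactAtlas c) (h' : IsCompactAtlas e)
    {W : Set (X × Y)} (hW : ∀ i j, IsOpen (Prod.map (c i) (e j) ⁻¹' W)) : IsOpen W := by
  obtain ⟨f, hf⟩ := Countable.exists_injective_nat ι
  obtain ⟨g, hg⟩ := Countable.exists_injective_nat κ
  rw [isOpen_prod_iff]
  intro a b hab
  obtain ⟨i₀, s₀, hs₀⟩ := h.cover a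
  obtain ⟨j₀, t₀, ht₀⟩ := h'.cover b
  let S : ℕ → Set ι := fun n => {i | f i ≤ n + f i₀}
  let S' : ℕ → Set κ := fun n => {i | g i ≤ n + g j₀}
  have hS : ∀ n, (S n).Finite := fun n => (Set.finite_Iic _).preimage hf.injOn
  have hS' : ∀ n, (S' n).Finite := fun n => (Set.finite_Iic _).preimage hg.injOn
  let Q := {p : Set X × Set Y // IsClosed p.1 ∧ IsClosed p.2 ∧ p.1 ×ˢ p.2 ⊆ W}
  have step : ∀ (n : ℕ) (p : Q), ∃ (p' : Q) (O : Set X) (O' : Set Y), IsOpen O ∧ IsOpen O' ∧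
      p.1.1 ⊆ O ∧ p.1.2 ⊆ O' ∧ (∀ i ∈ S n, ∀ s, c i s ∈ O → c i s ∈ p'.1.1) ∧
      (∀ i ∈ S' n, ∀ s, e i s ∈ O' → e i s ∈ p'.1.2) ∧
      (∀ x ∈ p'.1.1, ∃ i ∈ S n, ∃ s, c i s = x) ∧ (∀ x ∈ p'.1.2, ∃ i ∈ S' n, ∃ s, e i s = x) := by
    rintro n ⟨⟨A, B⟩, hA, hB, hAB⟩
    obtain ⟨O, A', O', B', h1, h2, h3, h4, h5, h6, h7, h8, h9⟩ :=
      h.exists_rectangle h' hW (S n) (hS n) (S' n) (hS' n) A hA B hB hAB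
    have hF : IsClosed (⋃ i ∈ S n, Set.range (c i)) := (hS n).isClosed_biUnion fun i _ =>
      (h.isClosedMap i).isClosed_range
    have hF' : IsClosed (⋃ i ∈ S' n, Set.range (e i)) := (hS' n).isClosed_biUnion fun i _ =>
      (h'.isClosedMap i).isClosed_range
    refine ⟨⟨⟨A' ∩ ⋃ i ∈ S n, Set.range (c i), B' ∩ ⋃ i ∈ S' n, Set.range (e i)⟩, h3.inter hF,
      h4.inter hF', fun x hx => h7 ⟨hx.1.1, hx.2.1⟩⟩, O, O', h1, h2, h5, h6, ?_, ?_, ?_, ?_⟩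
    · exact fun i hi s hs => ⟨h8 i hi s hs, Set.mem_biUnion hi ⟨s, rfl⟩⟩
    · exact fun i hi s hs => ⟨h9 i hi s hs, Set.mem_biUnion hi ⟨s, rfl⟩⟩
    · rintro x ⟨-, hx⟩
      simpa using hx
    · rintro x ⟨-, hx⟩
      simpa using hx
  choose next O O' hO hO' hAO hBO hOA hOB hAS hBS using step
  let p : ℕ → Q := fun n => Nat.rec ⟨({a}, {b}), h.isClosed_singleton a, h'.isClosed_singleton b,
    by simpa using hab⟩ (fun n q => next n q) n
  have hcov : ∀ n, ∀ x ∈ (p n).1.1, ∃ i ∈ S n, ∃ s, c i s = x := by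
    intro n x hx
    cases n with
    | zero => exact ⟨i₀, by simp [S], s₀, by rw [hs₀]; exact hx.symm⟩
    | succ n =>
      obtain ⟨i, hi, hs⟩ := hAS n (p n) x hx
      exact ⟨i, by simp only [S, Set.mem_ofPred_eq] at hi ⊢; omega, hs⟩
  have hcov' : ∀ n, ∀ x ∈ (p n).1.2, ∃ i ∈ S' n, ∃ s, e i s = x := by
    intro n x hx
    cases n with
    | zero => exact ⟨j₀, by simp [S'], t₀, by rw [ht₀]; exact hx.symm⟩
    | succ n =>
      obtain ⟨i, hi, hs⟩ := hBS n (p n) x hx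
      exact ⟨i, by simp only [S', Set.mem_ofPred_eq] at hi ⊢; omega, hs⟩
  have hA : Monotone fun n => (p n).1.1 := monotone_nat_of_le_succ fun n x hx => by
    obtain ⟨i, hi, s, rfl⟩ := hcov n x hx
    exact hOA n (p n) i hi s (hAO n (p n) hx)
  have hB : Monotone fun n => (p n).1.2 := monotone_nat_of_le_succ fun n x hx => by
    obtain ⟨i, hi, s, rfl⟩ := hcov' n x hx
    exact hOB n (p n) i hi s (hBO n (p n) hx)
  refine ⟨⋃ n, (p n).1.1, ⋃ n, (p n).1.2, ?_, ?_, Set.mem_iUnion.2 ⟨0, rfl⟩,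
    Set.mem_iUnion.2 ⟨0, rfl⟩, ?_⟩
  · exact h.isOpen_iUnion_of_charts f _ (fun n => O n (p n)) (fun n => hO n _)
      (fun n => hAO n _) hA fun n i hi => hOA n (p n) i (Nat.le_add_right_of_le hi)
  · exact h'.isOpen_iUnion_of_charts g _ (fun n => O' n (p n)) (fun n => hO' n _)
      (fun n => hBO n _) hB fun n i hi => hOB n (p n) i (Nat.le_add_right_of_le hi)
  · rintro ⟨x, y⟩ ⟨hx, hy⟩
    obtain ⟨n, hn⟩ := Set.mem_iUnion.1 hx
    obtain ⟨m, hm⟩ := Set.mem_iUnion.1 hy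
    exact (p (n + m)).2.2.2 ⟨hA (Nat.le_add_right n m) hn, hB (Nat.le_add_left m n) hm⟩

end IsCompactAtlas

/-- The sum of the first `j` entries. -/
def partialSum {n : ℕ} (s : Fin n → ℝ) (j : ℕ) : ℝ := ∑ i with i.1 < j, s i

theorem partialSum_zero {n : ℕ} (s : Fin n → ℝ) : partialSum s 0 = 0 := by
  simp [partialSum]

theorem partialSum_last {n : ℕ} (s : Fin n → ℝ) : partialSum s n = ∑ i, s i := by
  simp [partialSum]

theorem partialSum_succ {n : ℕ} (s : Fin n → ℝ) (j : Fin n) :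
    partialSum s (j + 1) = partialSum s j + s j := by
  have : (Finset.univ.filter fun i : Fin n => i.1 < j + 1) =
      insert j (Finset.univ.filter fun i : Fin n => i.1 < j) := by
    ext i
    simp only [Finset.mem_filter, Finset.mem_univ, true_and, Finset.mem_insert, Fin.ext_iff]
    omega
  rw [partialSum, this, Finset.sum_insert (by simp), add_comm, partialSum]

theorem partialSum_mono {n : ℕ} {s : Fin n → ℝ} (hs : ∀ i, 0 ≤ s i) : Monotone (partialSum s) := by
  intro i j hij
  refine Finset.sum_le_sum_of_subset_of_nonneg (fun k hk => ?_) fun k _ _ => hs k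
  simp only [Finset.mem_filter, Finset.mem_univ, true_and] at hk ⊢
  omega

theorem partialSum_telescope (f : ℕ → ℝ) (n i : ℕ) (hi : i ≤ n) :
    partialSum (fun k : Fin n => f (k + 1) - f k) i = f i - f 0 := by
  induction i with
  | zero => simp [partialSum_zero]
  | succ i ih =>
    rw [partialSum_succ _ ⟨i, hi⟩, ih (by omega)]
    ring

theorem eq_of_partialSum {n : ℕ} {s t : Fin n → ℝ}
    (h : ∀ j ≤ n, partialSum s j = partialSum t j) : s = t := by
  ext j
  have h1 := partialSum_succ s j
  rw [h _ j.2, h _ j.2.le, partialSum_succ] at h1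
  linarith

theorem partialSum_map {m n : ℕ} (α : Fin m → Fin n) (u : stdSimplex ℝ (Fin m)) (j : ℕ) :
    partialSum (stdSimplex.map α u : stdSimplex ℝ (Fin n)) j = ∑ k with (α k).1 < j, u k := by
  classical
  have : ∀ i, (stdSimplex.map α u : stdSimplex ℝ (Fin n)) i = ∑ k with α k = i, u k := fun i =>
    FunOnFinite.linearMap_apply_apply ..
  simp only [partialSum, this]
  rw [← Finset.sum_fiberwise_of_maps_to (s := Finset.univ.filter fun k => (α k).1 < j)
    (t := Finset.univ.filter fun i : Fin n => i.1 < j) (g := α) (by simp)]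
  refine Finset.sum_congr rfl fun i hi => Finset.sum_congr ?_ fun _ _ => rfl
  ext k
  simp only [Finset.mem_filter, Finset.mem_univ, true_and] at hi ⊢
  constructor
  · rintro rfl
    exact ⟨hi, rfl⟩
  · exact fun h => h.2

theorem le_of_map_eq {m n : ℕ} {α β : Fin m →o Fin n} {u : stdSimplex ℝ (Fin m)}
    (hu : ∀ k, 0 < u k) (h : stdSimplex.map α u = stdSimplex.map β u) (k : Fin m) : β k ≤ α k := by
  by_contra! hk
  have h1 := partialSum_map α u (β k)
  rw [h, partialSum_map] at h1
  refine h1.not_lt (Finset.sum_lt_sum_of_subset (i := k) (fun i hi => ?_) (by simpa using hk)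
    (by simp) (hu k) fun i _ _ => (hu i).le)
  simp only [Finset.mem_filter, Finset.mem_univ, true_and] at hi ⊢
  have : i ≤ k := by
    by_contra! hik
    exact (β.monotone hik.le).not_gt hi
  exact lt_of_le_of_lt (α.monotone this) hk

/-- A monotone map is determined by the image of an interior point of the simplex. -/
theorem orderHom_eq_of_map_eq {m n : ℕ} {α β : Fin m →o Fin n} {u : stdSimplex ℝ (Fin m)}
    (hu : ∀ k, 0 < u k) (h : stdSimplex.map α u = stdSimplex.map β u) : α = β :=
  OrderHom.ext _ _ (funext fun k => le_antisymm (le_of_map_eq hu h.symm k) (le_of_map_eq hu h k))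

/-- The distances between the consecutive points of a subdivision of `[0, 1]`. -/
def stdSimplex.ofSubdivision (p : ℕ) (f : ℕ → ℝ) (h0 : f 0 = 0) (h1 : f (p + 1) = 1)
    (hf : ∀ i ≤ p, f i < f (i + 1)) : stdSimplex ℝ (Fin (p + 1)) :=
  ⟨fun k => f (k + 1) - f k, fun k => sub_nonneg.2 (hf k (by omega)).le, by
    rw [← partialSum_last, partialSum_telescope _ _ _ le_rfl, h0, h1, sub_zero]⟩

theorem exists_map_ofSubdivision (p : ℕ) (f : ℕ → ℝ) (h0 : f 0 = 0) (h1 : f (p + 1) = 1)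
    (hf : ∀ i ≤ p, f i < f (i + 1)) {m : ℕ} (s : stdSimplex ℝ (Fin (m + 1)))
    (hs : ∀ j ≤ m, ∃ i ≤ p + 1, f i = partialSum s j) :
    ∃ α : Fin (p + 1) →o Fin (m + 1),
      stdSimplex.map α (stdSimplex.ofSubdivision p f h0 h1 hf) = s := by
  classical
  have hmono : ∀ i j, i ≤ j → j ≤ p + 1 → f i ≤ f j := by
    intro i j hij hj
    induction j, hij using Nat.le_induction with
    | base => exact le_rfl
    | succ j hij ih => exact (ih (by omega)).trans (hf j (by omega)).le
  have hlt : ∀ i j, i ≤ p + 1 → j ≤ p + 1 → (f i < f j ↔ i < j) := by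
    intro i j hi hj
    constructor
    · intro h
      by_contra! hji
      exact (hmono j i hji hi).not_gt h
    · intro h
      exact (hf i (by omega)).trans_le (hmono (i + 1) j h hj)
  have hsm := partialSum_mono (s := s) s.2.1
  have hmax : ∀ k : Fin (p + 1), ∃ a : Fin (m + 1), ∀ j : Fin (m + 1),
      j ≤ a ↔ partialSum s j ≤ f k := by
    intro k
    let S := Finset.univ.filter fun j : Fin (m + 1) => partialSum s j ≤ f k
    have hS : S.Nonempty := ⟨0, by
      simp only [S, Finset.mem_filter, Finset.mem_univ, true_and, Fin.val_zero, partialSum_zero]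
      rw [← h0]
      exact hmono 0 k (by omega) (by omega)⟩
    refine ⟨S.max' hS, fun j => ⟨fun hj => ?_, fun hj => S.le_max' _ (by simpa [S] using hj)⟩⟩
    have := S.max'_mem hS
    simp only [S, Finset.mem_filter, Finset.mem_univ, true_and] at this
    exact (hsm hj).trans this
  choose α hα using hmax
  have hαm : Monotone α := fun k k' hk =>
    (hα k' _).2 (((hα k _).1 le_rfl).trans (hmono _ _ hk (by omega)))
  suffices h : ∀ j ≤ m + 1, ∑ k with (α k).1 < j, stdSimplex.ofSubdivision p f h0 h1 hf k =
      partialSum s j from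
    ⟨⟨α, hαm⟩, Subtype.ext (eq_of_partialSum fun j hj => (partialSum_map _ _ j).trans (h j hj))⟩
  intro j hj
  rcases hj.lt_or_eq with hj | rfl
  · obtain ⟨i, hi, hij⟩ := hs j (by omega)
    rw [← hij, ← sub_zero (f i), ← h0, ← partialSum_telescope f (p + 1) i hi]
    refine Finset.sum_congr (Finset.filter_congr fun k _ => ?_) fun _ _ => rfl
    have h2 := hα k ⟨j, hj⟩
    dsimp only at h2
    rw [← hij] at h2
    rw [← hlt k i (by omega) hi, ← not_le, ← not_le]
    exact not_congr h2
  · rw [Finset.filter_true_of_mem fun k _ => (α k).2, partialSum_last]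
    exact (stdSimplex.ofSubdivision p f h0 h1 hf).2.2.trans s.2.2.symm

theorem exists_subdivision (F : Finset ℝ) (h0 : (0 : ℝ) ∈ F) (h1 : (1 : ℝ) ∈ F)
    (hF : ∀ x ∈ F, 0 ≤ x ∧ x ≤ 1) :
    ∃ (p : ℕ) (f : ℕ → ℝ), f 0 = 0 ∧ f (p + 1) = 1 ∧ (∀ i ≤ p, f i < f (i + 1)) ∧
      ∀ x ∈ F, ∃ i ≤ p + 1, f i = x := by
  have hc : 2 ≤ F.card := by
    have := Finset.card_le_card (show ({0, 1} : Finset ℝ) ⊆ F by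
      intro x hx
      simp only [Finset.mem_insert, Finset.mem_singleton] at hx
      rcases hx with rfl | rfl <;> assumption)
    rwa [Finset.card_pair zero_ne_one] at this
  obtain ⟨p, hp⟩ : ∃ p, F.card = p + 2 := ⟨F.card - 2, by omega⟩
  let e := F.orderEmbOfFin hp
  have he : ∀ x ∈ F, ∃ i, e i = x := fun x hx => by
    have : x ∈ Set.range e := by simpa [e] using hx
    exact this
  have hemem : ∀ i, e i ∈ F := F.orderEmbOfFin_mem hp
  let f : ℕ → ℝ := fun i => if h : i < p + 2 then e ⟨i, h⟩ else 0
  have hf : ∀ i (h : i < p + 2), f i = e ⟨i, h⟩ := fun i h => dif_pos h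
  refine ⟨p, f, ?_, ?_, ?_, ?_⟩
  · rw [hf _ (by omega)]
    obtain ⟨i, hi⟩ := he 0 h0
    refine le_antisymm ?_ (hF _ (hemem _)).1
    rw [← hi]
    exact e.monotone (Fin.zero_le i)
  · rw [hf _ (by omega)]
    obtain ⟨i, hi⟩ := he 1 h1
    refine le_antisymm (hF _ (hemem _)).2 ?_
    rw [← hi]
    exact e.monotone (Fin.le_last i)
  · intro i hi
    rw [hf _ (by omega), hf _ (by omega)]
    exact e.strictMono (by simp)
  · intro x hx
    obtain ⟨i, hi⟩ := he x hx
    exact ⟨i, by omega, (hf i i.2).trans hi⟩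

/-- Two points of simplices are images of one interior point of a simplex. -/
theorem exists_common_refinement {m n : ℕ} (s : stdSimplex ℝ (Fin (m + 1)))
    (t : stdSimplex ℝ (Fin (n + 1))) :
    ∃ (p : ℕ) (u : stdSimplex ℝ (Fin (p + 1))) (α : Fin (p + 1) →o Fin (m + 1))
      (β : Fin (p + 1) →o Fin (n + 1)), (∀ k, 0 < u k) ∧ stdSimplex.map α u = s ∧
        stdSimplex.map β u = t := by
  classical
  have h1 : ∀ {m : ℕ} (s : stdSimplex ℝ (Fin (m + 1))), partialSum s (m + 1) = 1 := fun s =>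
    (partialSum_last _).trans s.2.2
  have h2 : ∀ {m : ℕ} (s : stdSimplex ℝ (Fin (m + 1))), ∀ j ∈ Finset.range (m + 2),
      0 ≤ partialSum s j ∧ partialSum s j ≤ 1 := by
    intro m s j hj
    have hm := partialSum_mono (s := s) s.2.1
    rw [Finset.mem_range] at hj
    exact ⟨(partialSum_zero s).symm.trans_le (hm (Nat.zero_le j)),
      (hm (by omega : j ≤ m + 1)).trans (h1 s).le⟩
  obtain ⟨p, f, hf0, hf1, hf, hF⟩ := exists_subdivision
    ((Finset.range (m + 2)).image (partialSum s) ∪ (Finset.range (n + 2)).image (partialSum t))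
    (Finset.mem_union_left _ (Finset.mem_image.2 ⟨0, by simp, partialSum_zero _⟩))
    (Finset.mem_union_left _ (Finset.mem_image.2 ⟨m + 1, by simp, h1 s⟩)) (by
      intro x hx
      rcases Finset.mem_union.1 hx with hx | hx
      all_goals
        obtain ⟨j, hj, rfl⟩ := Finset.mem_image.1 hx
        exact h2 _ j hj)
  obtain ⟨α, hα⟩ := exists_map_ofSubdivision p f hf0 hf1 hf s fun j hj => hF _
    (Finset.mem_union_left _ (Finset.mem_image_of_mem _ (Finset.mem_range.2 (by omega))))
  obtain ⟨β, hβ⟩ := exists_map_ofSubdivision p f hf0 hf1 hf t fun j hj => hF _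
    (Finset.mem_union_right _ (Finset.mem_image_of_mem _ (Finset.mem_range.2 (by omega))))
  exact ⟨p, _, α, β, fun k => sub_pos.2 (hf k (by omega)), hα, hβ⟩

/-- Two monotone maps out of `Fin (p + 1)` factor through `Fin (m + n + 1)` by the composition of a
monotone map with monotone maps that factor through them. -/
theorem exists_factorization {p m n : ℕ} (α : Fin (p + 1) →o Fin (m + 1))
    (β : Fin (p + 1) →o Fin (n + 1)) :
    ∃ (c : Fin (p + 1) →o Fin (m + n + 1)) (i : Fin (m + n + 1) →o Fin (p + 1)),
      (α.comp i).comp c = α ∧ (β.comp i).comp c = β := by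
  classical
  let c : Fin (p + 1) →o Fin (m + n + 1) := ⟨fun k => ⟨α k + β k, by omega⟩, fun k k' h =>
    Fin.mk_le_mk.2 (add_le_add (α.monotone h) (β.monotone h))⟩
  let S : Fin (m + n + 1) → Finset (Fin (p + 1)) := fun j => insert 0 (Finset.univ.filter (c · ≤ j))
  have hS : ∀ j, (S j).Nonempty := fun j => Finset.insert_nonempty _ _
  let i : Fin (m + n + 1) →o Fin (p + 1) := ⟨fun j => (S j).max' (hS j), fun j j' h =>
    Finset.max'_subset _ (Finset.insert_subset_insert _ fun k hk => by
      simp only [Finset.mem_filter, Finset.mem_univ, true_and] at hk ⊢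
      exact hk.trans h)⟩
  have hle : ∀ k, k ≤ i (c k) := fun k => (S (c k)).le_max' _ (by simp [S])
  have hci : ∀ k, c (i (c k)) ≤ c k := by
    intro k
    have : i (c k) ∈ S (c k) := (S (c k)).max'_mem (hS _)
    simp only [S, Finset.mem_insert, Finset.mem_filter, Finset.mem_univ, true_and] at this
    rcases this with h | h
    · rw [h]
      exact c.monotone (Fin.zero_le k)
    · exact h
  have key : ∀ k, α (i (c k)) = α k ∧ β (i (c k)) = β k := by
    intro k
    have h1 : (α k).1 ≤ (α (i (c k))).1 := α.monotone (hle k)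
    have h2 : (β k).1 ≤ (β (i (c k))).1 := β.monotone (hle k)
    have h3 : (α (i (c k))).1 + (β (i (c k))).1 ≤ (α k).1 + (β k).1 := hci k
    exact ⟨Fin.ext (by omega), Fin.ext (by omega)⟩
  exact ⟨c, i, OrderHom.ext _ _ (funext fun k => (key k).1),
    OrderHom.ext _ _ (funext fun k => (key k).2)⟩

open Opposite

namespace Realization

variable {X Y : SSet.{0}}

/-- The canonical map from the topological simplex attached to a simplex `x` of `X` to the geometric
realization of `X`. -/
noncomputable def point {n : SimplexCategory} (x : X.obj (op n)) :
    C(stdSimplex ℝ (Fin (n.len + 1)), SSet.toTop.obj X) :=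
  TopCat.toSSetObjEquiv _ _ ((sSetTopAdj.unit.app X).app (op n) x)

theorem point_map {n m : SimplexCategory} (f : n ⟶ m) (x : X.obj (op m))
    (s : stdSimplex ℝ (Fin (n.len + 1))) :
    point (X.map f.op x) s = point x (stdSimplex.map f s) := by
  have h := congrArg (fun k => TopCat.toSSetObjEquiv _ _ (k x) s)
    ((sSetTopAdj.unit.app X).naturality f.op)
  exact h

theorem toTop_map_point (g : X ⟶ Y) {n : SimplexCategory} (x : X.obj (op n))
    (s : stdSimplex ℝ (Fin (n.len + 1))) :
    SSet.toTop.map g (point x s) = point (g.app _ x) s := by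
  have h := congrArg (fun k => TopCat.toSSetObjEquiv _ _ (k.app (op n) x) s)
    (sSetTopAdj.unit.naturality g)
  exact h.symm

/-- A continuous map out of a geometric realization from compatible continuous maps out of the
simplices. -/
theorem exists_desc {T : Type} [TopologicalSpace T]
    (φ : ∀ (n : SimplexCategory), X.obj (op n) → C(stdSimplex ℝ (Fin (n.len + 1)), T))
    (hφ : ∀ (n m : SimplexCategory) (f : n ⟶ m) (x : X.obj (op m))
      (s : stdSimplex ℝ (Fin (n.len + 1))), φ n (X.map f.op x) s = φ m x (stdSimplex.map f s)) :
    ∃ g : C(SSet.toTop.obj X, T), ∀ (n : SimplexCategory) (x : X.obj (op n)) s,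
      g (point x s) = φ n x s := by
  let k : X ⟶ TopCat.toSSet.obj (TopCat.of T) :=
    { app n := TypeCat.ofHom fun x =>
        (TopCat.toSSetObjEquiv (TopCat.of T) n).symm (φ n.unop x)
      naturality n m f := by
        ext x
        apply (TopCat.toSSetObjEquiv (TopCat.of T) m).injective
        ext s
        exact hφ m.unop n.unop f.unop x s }
  refine ⟨((sSetTopAdj.homEquiv X (TopCat.of T)).symm k).hom, fun n x s => ?_⟩
  have h := (sSetTopAdj.homEquiv X (TopCat.of T)).apply_symm_apply k
  rw [Adjunction.homEquiv_unit] at h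
  have h2 := congrArg (fun k => TopCat.toSSetObjEquiv _ _ (k.app (op n) x) s) h
  exact h2

theorem hom_ext_point {T : Type} [TopologicalSpace T] {g h : C(SSet.toTop.obj X, T)}
    (H : ∀ (n : SimplexCategory) (x : X.obj (op n)) s, g (point x s) = h (point x s)) : g = h := by
  have : TopCat.ofHom g = TopCat.ofHom h := by
    apply (sSetTopAdj.homEquiv X (TopCat.of T)).injective
    rw [Adjunction.homEquiv_unit, Adjunction.homEquiv_unit]
    ext n x
    apply (TopCat.toSSetObjEquiv (TopCat.of T) n).injective
    ext s
    exact H n.unop x s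
  exact congrArg TopCat.Hom.hom this

theorem exists_common_refinement {n m : SimplexCategory} (s : stdSimplex ℝ (Fin (n.len + 1)))
    (t : stdSimplex ℝ (Fin (m.len + 1))) :
    ∃ (p : SimplexCategory) (u : stdSimplex ℝ (Fin (p.len + 1))) (α : p ⟶ n) (β : p ⟶ m),
      (∀ k, 0 < u k) ∧ stdSimplex.map α u = s ∧ stdSimplex.map β u = t := by
  obtain ⟨p, u, α, β, h⟩ := _root_.exists_common_refinement s t
  exact ⟨.mk p, u, SimplexCategory.Hom.mk α, SimplexCategory.Hom.mk β, h⟩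

theorem hom_eq_of_map_eq {n m : SimplexCategory} {α β : n ⟶ m}
    {u : stdSimplex ℝ (Fin (n.len + 1))} (hu : ∀ k, 0 < u k)
    (h : stdSimplex.map α u = stdSimplex.map β u) : α = β :=
  SimplexCategory.Hom.ext _ _ (orderHom_eq_of_map_eq (α := α.toOrderHom) (β := β.toOrderHom) hu h)

theorem map_comp_apply {n m p : SimplexCategory} (α : n ⟶ m) (β : m ⟶ p)
    (u : stdSimplex ℝ (Fin (n.len + 1))) :
    stdSimplex.map (α ≫ β) u = stdSimplex.map β (stdSimplex.map α u) :=
  (stdSimplex.map_comp_apply α β u).symm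

theorem exists_factorization {n m p : SimplexCategory} (α : p ⟶ n) (β : p ⟶ m) :
    ∃ (c : p ⟶ .mk (n.len + m.len)) (i : SimplexCategory.mk (n.len + m.len) ⟶ p),
      c ≫ i ≫ α = α ∧ c ≫ i ≫ β = β := by
  obtain ⟨c, i, h1, h2⟩ := _root_.exists_factorization α.toOrderHom β.toOrderHom
  exact ⟨SimplexCategory.Hom.mk c, SimplexCategory.Hom.mk i, SimplexCategory.Hom.ext _ _ h1,
    SimplexCategory.Hom.ext _ _ h2⟩

/-- Two points of simplices of `X` are images of one point of a common degeneration. -/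
def Same {n m : SimplexCategory} (x : X.obj (op n)) (s : stdSimplex ℝ (Fin (n.len + 1)))
    (y : X.obj (op m)) (t : stdSimplex ℝ (Fin (m.len + 1))) : Prop :=
  ∃ (p : SimplexCategory) (u : stdSimplex ℝ (Fin (p.len + 1))) (α : p ⟶ n) (β : p ⟶ m),
    stdSimplex.map α u = s ∧ stdSimplex.map β u = t ∧ X.map α.op x = X.map β.op y

theorem Same.point_eq {n m : SimplexCategory} {x : X.obj (op n)}
    {s : stdSimplex ℝ (Fin (n.len + 1))} {y : X.obj (op m)} {t : stdSimplex ℝ (Fin (m.len + 1))}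
    (h : Same x s y t) : point x s = point y t := by
  obtain ⟨p, u, α, β, rfl, rfl, h⟩ := h
  rw [← point_map, ← point_map, h]

theorem map_op_comp {n m p : SimplexCategory} (α : n ⟶ m) (β : m ⟶ p) (x : X.obj (op p)) :
    X.map (α ≫ β).op x = X.map α.op (X.map β.op x) := by
  rw [op_comp, Functor.map_comp]
  rfl

theorem Same.trans {n m k : SimplexCategory} {x : X.obj (op n)}
    {s : stdSimplex ℝ (Fin (n.len + 1))} {y : X.obj (op m)} {t : stdSimplex ℝ (Fin (m.len + 1))}
    {z : X.obj (op k)} {r : stdSimplex ℝ (Fin (k.len + 1))}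
    (h : Same x s y t) (h' : Same y t z r) : Same x s z r := by
  obtain ⟨p, u, α, β, rfl, rfl, h⟩ := h
  obtain ⟨q, v, γ, δ, hγ, rfl, h'⟩ := h'
  obtain ⟨l, w, ε, ζ, hw, rfl, rfl⟩ := exists_common_refinement u v
  have key : ε ≫ β = ζ ≫ γ := hom_eq_of_map_eq hw (by rw [map_comp_apply, map_comp_apply, hγ])
  refine ⟨l, w, ε ≫ α, ζ ≫ δ, map_comp_apply _ _ _, map_comp_apply _ _ _, ?_⟩
  rw [map_op_comp, h, ← map_op_comp, key, map_op_comp, h', ← map_op_comp]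

/-- The equivalence relation on the points of the simplices of `X` whose quotient is the geometric
realization. -/
def setoid (X : SSet.{0}) :
    Setoid (Σ i : Σ n : SimplexCategory, X.obj (op n), stdSimplex ℝ (Fin (i.1.len + 1))) where
  r a b := Same a.1.2 a.2 b.1.2 b.2
  iseqv :=
    { refl a := ⟨_, a.2, 𝟙 _, 𝟙 _, stdSimplex.map_id_apply _, stdSimplex.map_id_apply _, rfl⟩
      symm := fun ⟨p, u, α, β, h1, h2, h3⟩ => ⟨p, u, β, α, h2, h1, h3.symm⟩
      trans := Same.trans }

theorem exists_quotient (X : SSet.{0}) :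
    ∃ (g : C(SSet.toTop.obj X, Quotient (setoid X))) (h : C(Quotient (setoid X), SSet.toTop.obj X)),
      (∀ y, h (g y) = y) ∧
      (∀ (n : SimplexCategory) (x : X.obj (op n)) s, g (point x s) = Quotient.mk _ ⟨⟨n, x⟩, s⟩) ∧
      ∀ (n : SimplexCategory) (x : X.obj (op n)) s, h (Quotient.mk _ ⟨⟨n, x⟩, s⟩) = point x s := by
  obtain ⟨g, hg⟩ := exists_desc (X := X) (T := Quotient (setoid X))
    (fun n x => ⟨fun s => Quotient.mk _ ⟨⟨n, x⟩, s⟩, continuous_quotient_mk'.comp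
      (continuous_sigmaMk (σ := fun i : Σ n : SimplexCategory, X.obj (op n) =>
        stdSimplex ℝ (Fin (i.1.len + 1))) (i := ⟨n, x⟩))⟩) (by
      intro n m f x s
      refine Quotient.sound ⟨n, s, 𝟙 _, f, stdSimplex.map_id_apply _, rfl, ?_⟩
      rw [op_id, CategoryTheory.Functor.map_id]
      rfl)
  let h : C(Quotient (setoid X), SSet.toTop.obj X) :=
    ⟨Quotient.lift (fun a => point a.1.2 a.2) fun a b hab => Same.point_eq hab,
      (continuous_sigma fun i => (point i.2).continuous).quotient_lift _⟩
  refine ⟨g, h, fun y => ?_, hg, fun _ _ _ => rfl⟩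
  have : h.comp g = ContinuousMap.id _ := hom_ext_point fun n x s => by
    change h (g (point x s)) = _
    rw [hg]
    rfl
  exact DFunLike.congr_fun this y

theorem point_eq_iff {n m : SimplexCategory} {x : X.obj (op n)}
    {s : stdSimplex ℝ (Fin (n.len + 1))} {y : X.obj (op m)} {t : stdSimplex ℝ (Fin (m.len + 1))} :
    point x s = point y t ↔ Same x s y t := by
  refine ⟨fun h => ?_, Same.point_eq⟩
  obtain ⟨g, -, -, hg, -⟩ := exists_quotient X
  have := congrArg g h
  rw [hg, hg] at this
  exact Quotient.exact this

theorem exists_point (a : SSet.toTop.obj X) :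
    ∃ (n : SimplexCategory) (x : X.obj (op n)) (s : _), point x s = a := by
  obtain ⟨g, h, hgh, -, hh⟩ := exists_quotient X
  obtain ⟨⟨⟨n, x⟩, s⟩, hs⟩ := Quotient.exists_rep (g a)
  exact ⟨n, x, s, by rw [← hgh a, ← hs, hh]⟩

theorem isOpen_of_point {U : Set (SSet.toTop.obj X)}
    (hU : ∀ (n : SimplexCategory) (x : X.obj (op n)), IsOpen (point x ⁻¹' U)) : IsOpen U := by
  obtain ⟨g, h, hgh, -, hh⟩ := exists_quotient X
  have h1 : IsOpen (h ⁻¹' U) := isQuotientMap_quotient_mk'.isOpen_preimage.1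
    (isOpen_sigma_iff.2 fun i => by
      convert hU i.1 i.2 using 1
      ext s
      exact iff_of_eq (congrArg (· ∈ U) (hh i.1 i.2 s)))
  convert h1.preimage g.continuous using 1
  ext y
  simp only [Set.mem_preimage, hgh]

theorem isCompactAtlas_point (X : SSet.{0}) :
    IsCompactAtlas fun (i : Σ n : ℕ, X.obj (op (SimplexCategory.mk n))) =>
      (point i.2 : _ → SSet.toTop.obj X) where
  continuous i := (point i.2).continuous
  cover a := by
    obtain ⟨n, x, s, h⟩ := exists_point a
    exact ⟨⟨n.len, x⟩, s, h⟩
  isOpen U hU := isOpen_of_point fun n x => hU ⟨n.len, x⟩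
  isClosed_overlap := by
    rintro ⟨n, x⟩ ⟨m, y⟩
    have : {p : stdSimplex ℝ (Fin (n + 1)) × stdSimplex ℝ (Fin (m + 1)) |
        point x p.1 = point y p.2} =
        ⋃ (α : SimplexCategory.mk (n + m) ⟶ .mk n) (β : SimplexCategory.mk (n + m) ⟶ .mk m)
          (_ : X.map α.op x = X.map β.op y),
          Set.range fun u : stdSimplex ℝ (Fin (n + m + 1)) =>
            (stdSimplex.map α u, stdSimplex.map β u) := by
      ext ⟨s, t⟩
      simp only [Set.mem_ofPred_eq, Set.mem_iUnion, Set.mem_range]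
      constructor
      · intro h
        obtain ⟨p, u, α, β, rfl, rfl, hxy⟩ := point_eq_iff.1 h
        obtain ⟨c, i, h1, h2⟩ := exists_factorization α β
        refine ⟨i ≫ α, i ≫ β, by rw [map_op_comp, map_op_comp, hxy], stdSimplex.map c u, ?_⟩
        have e1 := map_comp_apply c (i ≫ α) u
        have e2 := map_comp_apply c (i ≫ β) u
        rw [h1] at e1
        rw [h2] at e2
        exact Prod.ext e1.symm e2.symm
      · rintro ⟨α, β, h, u, hu⟩
        obtain ⟨rfl, rfl⟩ := Prod.ext_iff.1 hu
        exact point_eq_iff.2 ⟨_, u, α, β, rfl, rfl, h⟩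
    refine this ▸ isClosed_iUnion_of_finite fun α => isClosed_iUnion_of_finite fun β =>
      isClosed_iUnion_of_finite fun _ => (isCompact_range ?_).isClosed
    exact (stdSimplex.continuous_map _).prodMk (stdSimplex.continuous_map _)

/-- Geometric realization commutes with products of countable simplicial sets. -/
theorem isHomeomorph_prod {Z : SSet.{0}} (f : Z ⟶ X) (g : Z ⟶ Y)
    [∀ n, Countable (X.obj n)] [∀ n, Countable (Y.obj n)]
    (h : ∀ n, Function.Bijective fun z : Z.obj n => (f.app n z, g.app n z)) :
    IsHomeomorph fun z : SSet.toTop.obj Z => (SSet.toTop.map f z, SSet.toTop.map g z) := by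
  have hext : ∀ {n : SimplexCategory} {z z' : Z.obj (op n)},
      f.app _ z = f.app _ z' → g.app _ z = g.app _ z' → z = z' := fun h1 h2 =>
    (h _).1 (Prod.ext h1 h2)
  have hlift : ∀ {n m p : SimplexCategory} (x : X.obj (op n)) (y : Y.obj (op m)) (α : p ⟶ n)
      (β : p ⟶ m), ∃ z : Z.obj (op p), f.app _ z = X.map α.op x ∧ g.app _ z = Y.map β.op y := by
    intro n m p x y α β
    obtain ⟨z, hz⟩ := (h _).2 (X.map α.op x, Y.map β.op y)
    exact ⟨z, (Prod.ext_iff.1 hz).1, (Prod.ext_iff.1 hz).2⟩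
  have hcont : Continuous fun z : SSet.toTop.obj Z => (SSet.toTop.map f z, SSet.toTop.map g z) :=
    (SSet.toTop.map f).hom.continuous.prodMk (SSet.toTop.map g).hom.continuous
  have hinj : Function.Injective
      fun z : SSet.toTop.obj Z => (SSet.toTop.map f z, SSet.toTop.map g z) := by
    intro a b hab
    obtain ⟨n, z, s, rfl⟩ := exists_point a
    obtain ⟨m, z', t, rfl⟩ := exists_point b
    obtain ⟨h1, h2⟩ := Prod.ext_iff.1 hab
    dsimp only at h1 h2
    rw [toTop_map_point, toTop_map_point, point_eq_iff] at h1 h2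
    obtain ⟨p, u, α, β, rfl, rfl, h1⟩ := h1
    obtain ⟨q, v, γ, δ, hγ, hδ, h2⟩ := h2
    obtain ⟨l, w, ε, ζ, hw, rfl, rfl⟩ := exists_common_refinement u v
    have e1 : ζ ≫ γ = ε ≫ α := hom_eq_of_map_eq hw (by rw [map_comp_apply, map_comp_apply, hγ])
    have e2 : ζ ≫ δ = ε ≫ β := hom_eq_of_map_eq hw (by rw [map_comp_apply, map_comp_apply, hδ])
    refine Same.point_eq ⟨l, w, ε ≫ α, ε ≫ β, map_comp_apply _ _ _, map_comp_apply _ _ _, ?_⟩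
    refine hext ?_ ?_
    · rw [NatTrans.naturality_apply, NatTrans.naturality_apply, map_op_comp, h1, ← map_op_comp]
    · rw [NatTrans.naturality_apply, NatTrans.naturality_apply, ← e1, map_op_comp, h2,
        ← map_op_comp, e2]
  have hsurj : Function.Surjective
      fun z : SSet.toTop.obj Z => (SSet.toTop.map f z, SSet.toTop.map g z) := by
    rintro ⟨a, b⟩
    obtain ⟨n, x, s, rfl⟩ := exists_point a
    obtain ⟨m, y, t, rfl⟩ := exists_point b
    obtain ⟨p, u, α, β, -, rfl, rfl⟩ := exists_common_refinement s t
    obtain ⟨z, h1, h2⟩ := hlift x y α β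
    refine ⟨point z u, ?_⟩
    dsimp only
    rw [toTop_map_point, toTop_map_point, h1, h2, point_map, point_map]
  refine ⟨hcont, fun U hU => ?_, hinj, hsurj⟩
  refine (isCompactAtlas_point X).isOpen_prod (isCompactAtlas_point Y) ?_
  rintro ⟨n, x⟩ ⟨m, y⟩
  rw [← isClosed_compl_iff, ← Set.preimage_compl, ← Set.image_compl_eq ⟨hinj, hsurj⟩]
  choose z hz1 hz2 using fun (α : SimplexCategory.mk (n + m) ⟶ .mk n)
    (β : SimplexCategory.mk (n + m) ⟶ .mk m) => hlift x y α β
  have : Prod.map (point x) (point y) ⁻¹'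
        ((fun z : SSet.toTop.obj Z => (SSet.toTop.map f z, SSet.toTop.map g z)) '' Uᶜ) =
      ⋃ (α : SimplexCategory.mk (n + m) ⟶ .mk n) (β : SimplexCategory.mk (n + m) ⟶ .mk m),
        (fun u : stdSimplex ℝ (Fin (n + m + 1)) => (stdSimplex.map α u, stdSimplex.map β u)) ''
          (point (z α β) ⁻¹' Uᶜ) := by
    ext ⟨s, t⟩
    simp only [Set.mem_preimage, Set.mem_iUnion, Set.mem_image]
    constructor
    · rintro ⟨c, hc, hst⟩
      obtain ⟨p, u, α, β, -, rfl, rfl⟩ := exists_common_refinement (n := .mk n) (m := .mk m) s t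
      obtain ⟨c', i, h1, h2⟩ := exists_factorization α β
      have e1 := map_comp_apply c' (i ≫ α) u
      have e2 := map_comp_apply c' (i ≫ β) u
      rw [h1] at e1
      rw [h2] at e2
      refine ⟨i ≫ α, i ≫ β, stdSimplex.map c' u, ?_, Prod.ext e1.symm e2.symm⟩
      convert hc using 1
      refine hinj (Eq.trans ?_ hst.symm)
      dsimp only [Prod.map]
      rw [toTop_map_point, toTop_map_point, hz1, hz2, point_map, point_map, e1, e2]
    · rintro ⟨α, β, u, hu, hst⟩
      obtain ⟨rfl, rfl⟩ := Prod.ext_iff.1 hst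
      refine ⟨_, hu, ?_⟩
      dsimp only [Prod.map]
      rw [toTop_map_point, toTop_map_point, hz1, hz2, point_map, point_map]
  refine this ▸ isClosed_iUnion_of_finite fun α => isClosed_iUnion_of_finite fun β => ?_
  have hcl : IsClosed (point (z α β) ⁻¹' Uᶜ) := hU.isClosed_compl.preimage (point _).continuous
  exact (hcl.isCompact.image
    ((stdSimplex.continuous_map _).prodMk (stdSimplex.continuous_map _))).isClosed

end Realization

open Limits

namespace QuasiBraid

/-- The nerve of a group, viewed as a category with one object. -/
def groupNerve : GrpCat.{0} ⥤ SSet.{0} :=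
  forget₂ GrpCat MonCat ⋙ MonCat.toCat ⋙ nerveFunctor

/-- A string of `n` composable arrows in a group is a sequence of `n` elements. -/
noncomputable def composableArrowsEquiv (G : Type) [Group G] (n : ℕ) :
    ComposableArrows (SingleObj G) n ≃ (Fin n → G) where
  toFun F i := F.map' i (i + 1)
  invFun f := ComposableArrows.mkOfObjOfMapSucc (fun _ => SingleObj.star G) fun i => f i
  left_inv F := by
    refine ComposableArrows.ext (fun _ => rfl) fun i hi => ?_
    refine (ComposableArrows.mkOfObjOfMapSucc_map_succ _ _ i hi).trans ?_
    simp
  right_inv f := funext fun i => ComposableArrows.mkOfObjOfMapSucc_map_succ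
    (fun _ => SingleObj.star G) (fun i => f i) i.1 i.2

/-- The `n`-simplices of the nerve of a group are the sequences of `n` elements. -/
noncomputable def groupNerveEquiv (G : GrpCat.{0}) (n : SimplexCategoryᵒᵖ) :
    (groupNerve.obj G).obj n ≃ (Fin n.unop.len → G) :=
  composableArrowsEquiv G n.unop.len

theorem groupNerveEquiv_map {G H : GrpCat.{0}} (f : G ⟶ H) (n : SimplexCategoryᵒᵖ)
    (F : (groupNerve.obj G).obj n) (i : Fin n.unop.len) :
    groupNerveEquiv H n ((groupNerve.map f).app n F) i = f.hom (groupNerveEquiv G n F i) :=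
  rfl

instance (G : GrpCat.{0}) [Countable G] (n : SimplexCategoryᵒᵖ) :
    Countable ((groupNerve.obj G).obj n) :=
  (groupNerveEquiv G n).injective.countable

theorem isHomeomorph_B_prod (G H : Type) [Group G] [Group H] [Countable G] [Countable H] :
    IsHomeomorph fun z : B.obj (GrpCat.of (G × H)) =>
      (B.map (GrpCat.ofHom (MonoidHom.fst G H)) z, B.map (GrpCat.ofHom (MonoidHom.snd G H)) z) := by
  have : Countable (GrpCat.of G) := ‹Countable G›
  have : Countable (GrpCat.of H) := ‹Countable H›
  refine Realization.isHomeomorph_prod (groupNerve.map (GrpCat.ofHom (MonoidHom.fst G H)))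
    (groupNerve.map (GrpCat.ofHom (MonoidHom.snd G H))) fun n => ⟨fun z z' h => ?_, fun p => ?_⟩
  · obtain ⟨h1, h2⟩ := Prod.ext_iff.1 h
    apply (groupNerveEquiv _ n).injective
    funext i
    exact Prod.ext (congrFun (congrArg (groupNerveEquiv (GrpCat.of G) n) h1) i)
      (congrFun (congrArg (groupNerveEquiv (GrpCat.of H) n) h2) i)
  · refine ⟨(groupNerveEquiv (GrpCat.of (G × H)) n).symm fun i =>
      (groupNerveEquiv (GrpCat.of G) n p.1 i, groupNerveEquiv (GrpCat.of H) n p.2 i), ?_⟩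
    refine Prod.ext ((groupNerveEquiv (GrpCat.of G) n).injective (funext fun i => ?_))
      ((groupNerveEquiv (GrpCat.of H) n).injective (funext fun i => ?_))
    all_goals
      dsimp only
      rw [groupNerveEquiv_map, Equiv.apply_symm_apply]
      rfl

theorem exists_isColimit_B (F : ℕ ⥤ GrpCat.{0}) {c : Cocone F} (hc : IsColimit c) :
    Nonempty (IsColimit (B.mapCocone c)) := by
  have hmap : ∀ {i j k : ℕ} (f : i ⟶ j) (g : j ⟶ k) (x : F.obj i),
      (F.map (f ≫ g)).hom x = (F.map g).hom ((F.map f).hom x) := fun f g x => by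
    rw [F.map_comp]
    rfl
  have hw : ∀ {i j : ℕ} (f : i ⟶ j) (x : F.obj i),
      (c.ι.app j).hom ((F.map f).hom x) = (c.ι.app i).hom x := fun f x => by
    rw [← c.w f]
    rfl
  have h1 : IsColimit (groupNerve.mapCocone c) := by
    refine evaluationJointlyReflectsColimits _ fun n => ?_
    refine Types.FilteredColimit.isColimitOf _ _ (fun x => ?_) fun i j x y hxy => ?_
    · choose i y hy using fun t => Concrete.isColimit_exists_rep F hc (groupNerveEquiv c.pt n x t)
      refine ⟨Finset.univ.sup i, (groupNerveEquiv _ n).symm fun t =>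
        (F.map (homOfLE (Finset.le_sup (f := i) (Finset.mem_univ t)))).hom (y t), ?_⟩
      apply (groupNerveEquiv c.pt n).injective
      funext t
      refine Eq.trans ?_ (groupNerveEquiv_map (c.ι.app (Finset.univ.sup i)) n _ t).symm
      rw [Equiv.apply_symm_apply, hw]
      exact (hy t).symm
    · choose k f g hk using fun t => Concrete.isColimit_exists_of_rep_eq F hc
        (groupNerveEquiv _ n x t) (groupNerveEquiv _ n y t)
        (congrFun (congrArg (groupNerveEquiv c.pt n) hxy) t)
      let K := max (max i j) (Finset.univ.sup k)
      have hkK : ∀ t, k t ≤ K := fun t =>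
        (Finset.le_sup (f := k) (Finset.mem_univ t)).trans (le_max_right _ _)
      refine ⟨K, homOfLE ((le_max_left i j).trans (le_max_left _ _)),
        homOfLE ((le_max_right i j).trans (le_max_left _ _)), ?_⟩
      apply (groupNerveEquiv (F.obj K) n).injective
      funext t
      refine (groupNerveEquiv_map (F.map _) n x t).trans
        (Eq.trans ?_ (groupNerveEquiv_map (F.map _) n y t).symm)
      have h1 := congrArg (F.map (homOfLE (hkK t))).hom (hk t)
      exact (hmap (f t) _ _).trans (h1.trans (hmap (g t) _ _).symm)
  exact ⟨isColimitOfPreserves SSet.toTop h1⟩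

instance (n : ℕ) : Countable (Interval n) :=
  Function.Injective.countable (f := fun T : Interval n => (T.lo, T.hi)) (by
    rintro ⟨a, b, _, _⟩ ⟨c, d, _, _⟩ h
    simpa using h)

instance (n : ℕ) : Countable (J n) := by
  have : Countable (FreeGroup (Interval n)) := inferInstanceAs (Countable (Quot _))
  exact inferInstanceAs (Countable (Quotient _))

section ListProducts

variable {ι κ G : Type*} [Monoid G]

theorem prod_map_mul_of_commute (f g : ι → G) (L : List ι) (hL : L.Nodup)
    (h : ∀ i ∈ L, ∀ j ∈ L, i ≠ j → Commute (f i) (g j)) :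
    (L.map f).prod * (L.map g).prod = (L.map fun i => f i * g i).prod := by
  induction L with
  | nil => simp
  | cons i L ih =>
    obtain ⟨hi, hL⟩ := List.nodup_cons.1 hL
    have hc : Commute (L.map f).prod (g i) := by
      refine Commute.list_prod_left _ _ fun x hx => ?_
      obtain ⟨j, hj, rfl⟩ := List.mem_map.1 hx
      exact h j (by simp [hj]) i (by simp) (by rintro rfl; exact hi hj)
    simp only [List.map_cons, List.prod_cons]
    rw [← ih hL fun a ha b hb => h a (by simp [ha]) b (by simp [hb]), mul_assoc,
      ← mul_assoc _ (g i), hc.eq]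
    simp only [mul_assoc]

theorem prod_map_prod_comm (f : ι → κ → G) (L : List ι) (hL : L.Nodup) (M : List κ)
    (h : ∀ i ∈ L, ∀ j ∈ L, i ≠ j → ∀ r ∈ M, ∀ r' ∈ M, Commute (f i r) (f j r')) :
    (M.map fun r => (L.map fun i => f i r).prod).prod =
      (L.map fun i => (M.map fun r => f i r).prod).prod := by
  induction M with
  | nil => simp
  | cons r M ih =>
    simp only [List.map_cons, List.prod_cons]
    rw [ih fun i hi j hj hij a ha b hb => h i hi j hj hij a (by simp [ha]) b (by simp [hb]),
      prod_map_mul_of_commute _ _ _ hL]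
    intro i hi j hj hij
    refine Commute.list_prod_right _ _ fun x hx => ?_
    obtain ⟨b, hb, rfl⟩ := List.mem_map.1 hx
    exact h i hi j hj hij r (by simp) b (by simp [hb])

theorem prod_map_conj_single (f : ι → G) (y y' : G) (L : List ι) (hL : L.Nodup) (i : ι)
    (hi : i ∈ L) (hf : f i * y = y' * f i)
    (h : ∀ j ∈ L, j ≠ i → Commute (f j) y ∧ Commute (f j) y') :
    (L.map f).prod * y = y' * (L.map f).prod := by
  induction L with
  | nil => simp at hi
  | cons j L ih =>
    obtain ⟨hj, hL⟩ := List.nodup_cons.1 hL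
    simp only [List.map_cons, List.prod_cons]
    by_cases hij : j = i
    · subst hij
      have hc : Commute (L.map f).prod y := by
        refine Commute.list_prod_left _ _ fun x hx => ?_
        obtain ⟨a, ha, rfl⟩ := List.mem_map.1 hx
        exact (h a (by simp [ha]) (by rintro rfl; exact hj ha)).1
      rw [mul_assoc, hc.eq, ← mul_assoc, hf, mul_assoc]
    · have hi' : i ∈ L := by
        rcases List.mem_cons.1 hi with rfl | h
        · exact absurd rfl hij
        · exact h
      rw [mul_assoc, ih hL hi' fun a ha => h a (by simp [ha]), ← mul_assoc,
        (h j (by simp) hij).2.eq, mul_assoc]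

end ListProducts

theorem J.hom_ext {n : ℕ} {G : Type*} [Group G] {f g : J n →* G}
    (h : ∀ a b, a < b → b < n → f (gen n a b) = g (gen n a b)) : f = g := by
  refine PresentedGroup.ext fun T => ?_
  have := h T.lo T.hi T.lo_lt_hi T.hi_lt
  unfold gen at this
  rw [dif_pos ⟨T.lo_lt_hi, T.hi_lt⟩] at this
  exact this

theorem J.commute_of_gen {n : ℕ} {G : Type*} [Group G] (f : J n →* G) (y : G)
    (h : ∀ a b, a < b → b < n → Commute (f (gen n a b)) y) (x : J n) : Commute (f x) y := by
  have h1 : (⊤ : Subgroup (J n)) ≤ (Subgroup.centralizer {y}).comap f := by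
    rw [← PresentedGroup.closure_range_of, Subgroup.closure_le]
    rintro _ ⟨T, rfl⟩
    have := h T.lo T.hi T.lo_lt_hi T.hi_lt
    unfold gen at this
    rw [dif_pos ⟨T.lo_lt_hi, T.hi_lt⟩] at this
    exact Subgroup.mem_centralizer_singleton_iff.2 this.symm.eq.symm
  exact (Subgroup.mem_centralizer_singleton_iff.1 (h1 (Subgroup.mem_top x)))

theorem gen_of_le {n a b : ℕ} (h : b ≤ a) : gen n a b = 1 := dif_neg (by omega)

theorem gen_blocks_commute {N w c d c' d' i j : ℕ} (hd : d < w) (hd' : d' < w) (hij : i ≠ j) :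
    Commute (gen N (i * w + c) (i * w + d)) (gen N (j * w + c') (j * w + d')) := by
  refine gen_separated _ _ _ _ _ ?_
  rcases lt_or_gt_of_ne hij with h | h
  · have := Nat.mul_le_mul_right w (Nat.succ_le_of_lt h)
    rw [Nat.succ_mul] at this
    omega
  · have := Nat.mul_le_mul_right w (Nat.succ_le_of_lt h)
    rw [Nat.succ_mul] at this
    omega

theorem gen_blocks_commute_self {N w c d : ℕ} (hd : d < w) (i j : ℕ) :
    Commute (gen N (i * w + c) (i * w + d)) (gen N (j * w + c) (j * w + d)) := by
  by_cases h : i = j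
  · rw [h]
  · exact gen_blocks_commute hd hd h

/-- The product of the flips of the copies of `[c, d]` in the blocks `s, …, s + m - 1` of width
`w`. -/
def blockProd (N w c d s m : ℕ) : J N :=
  ((List.range' s m).map fun i => gen N (i * w + c) (i * w + d)).prod

theorem blockProd_add (N w c d s m m' : ℕ) :
    blockProd N w c d s (m + m') = blockProd N w c d s m * blockProd N w c d (s + m) m' := by
  unfold blockProd
  rw [← List.prod_append, ← List.map_append, List.range'_append_1]

theorem blockProd_sq {N w c d : ℕ} (hd : d < w) (s m : ℕ) :
    blockProd N w c d s m * blockProd N w c d s m = 1 :=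
  prod_map_sq _ (fun _ => gen_sq _ _ _) (gen_blocks_commute_self hd) _

theorem pairs_eq_blockProd (n a b : ℕ) : pairs n a b = blockProd n 2 0 1 a (b + 1 - a) := by
  unfold pairs blockProd
  simp only [mul_comm 2, add_zero]

theorem block_lt {i c n a : ℕ} (hi : i < c) (ha : a < n) : i * n + a < c * n := by
  have := Nat.mul_le_mul_right n (Nat.succ_le_of_lt hi)
  rw [Nat.succ_mul] at this
  omega

/-- The homomorphism `J_n → J_{cn}` that copies a generator into each of `c` consecutive blocks of
`n` letters. -/
def copies (n N c : ℕ) (hN : N = c * n) : J n →* J N :=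
  J.lift (fun T => blockProd N n T.lo T.hi 0 c)
    (fun T => blockProd_sq T.hi_lt 0 c)
    (by
      intro T T' h
      have h1 := T'.lo_lt_hi
      have h2 := T.hi_lt
      have h3 := h.1
      have h4 := h.2
      unfold blockProd
      rw [prod_map_mul_of_commute _ _ _ List.nodup_range' fun i _ j _ hij =>
          gen_blocks_commute T.hi_lt T'.hi_lt hij,
        prod_map_mul_of_commute _ _ _ List.nodup_range' fun i _ j _ hij =>
          gen_blocks_commute (T.reflect T' h).hi_lt T.hi_lt hij]
      refine congrArg List.prod (List.map_congr_left fun i hi => ?_)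
      rw [List.mem_range'_1] at hi
      have hlt := block_lt (i := i) (c := c) (by omega) T.hi_lt
      rw [gen_nested _ _ _ _ _ (by omega) (by omega) (by omega) (by omega)]
      dsimp only [Interval.reflect]
      congr 2 <;> omega)
    (by
      intro T T' h
      unfold Interval.Separated at h
      unfold blockProd
      rw [prod_map_mul_of_commute _ _ _ List.nodup_range' fun i _ j _ hij =>
          gen_blocks_commute T.hi_lt T'.hi_lt hij,
        prod_map_mul_of_commute _ _ _ List.nodup_range' fun i _ j _ hij =>
          gen_blocks_commute T'.hi_lt T.hi_lt hij]
      refine congrArg List.prod (List.map_congr_left fun i hi => ?_)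
      exact gen_separated _ _ _ _ _ (by omega))

theorem copies_gen {n N c : ℕ} (hN : N = c * n) {a b : ℕ} (hb : b < n) :
    copies n N c hN (gen n a b) = blockProd N n a b 0 c := by
  by_cases hab : a < b
  · have : gen n a b = alpha ⟨a, b, hab, hb⟩ := dif_pos ⟨hab, hb⟩
    rw [this]
    exact J.lift_alpha ..
  · rw [gen_of_le (by omega), map_one, blockProd, eq_comm]
    refine List.prod_eq_one fun x hx => ?_
    obtain ⟨i, -, rfl⟩ := List.mem_map.1 hx
    exact gen_of_le (by omega)

theorem expand_gen {n N : ℕ} (hN : N = 2 * n) {a b : ℕ} (hab : a ≤ b) (hb : b < n) :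
    expand n N hN (gen n a b) = gen N (2 * a) (2 * b + 1) * pairs N a b := by
  rcases hab.lt_or_eq with hab | rfl
  · have : gen n a b = alpha ⟨a, b, hab, hb⟩ := dif_pos ⟨hab, hb⟩
    rw [this]
    exact J.lift_alpha ..
  · have : pairs N a a = gen N (2 * a) (2 * a + 1) := by simp [pairs]
    rw [gen_of_le le_rfl, map_one, this, gen_sq]

/-- The product of the flips of the first `m` pairs of letters from the pair `s` on is
compatible with grouping the pairs into blocks. -/
theorem prod_pairs_blocks (N w s m : ℕ) (hw : 0 < w) :
    ((List.range' s m).map fun i => pairs N (i * w) (i * w + (w - 1))).prod =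
      blockProd N 2 0 1 (s * w) (m * w) := by
  induction m with
  | zero => simp [blockProd]
  | succ m ih =>
    rw [List.range'_1_concat, List.map_append, List.prod_append, ih, Nat.succ_mul, blockProd_add,
      List.map_singleton, List.prod_singleton, pairs_eq_blockProd, ← Nat.add_mul]
    congr 2
    omega

theorem expand_cable {n N w a b : ℕ} (hN : N = 2 * n) (hw : 0 < w) (hab : a ≤ b)
    (hb : (b + 1) * w ≤ n) :
    expand n N hN (gen n (a * w) (b * w + (w - 1)) * blockProd n w 0 (w - 1) a (b + 1 - a)) =
      gen N (a * (2 * w)) (b * (2 * w) + (2 * w - 1)) *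
        blockProd N (2 * w) 0 (2 * w - 1) a (b + 1 - a) := by
  have hle : ∀ {i j : ℕ}, i ≤ j → i * w ≤ j * w := fun h => Nat.mul_le_mul_right w h
  have hab' := hle hab
  rw [Nat.succ_mul] at hb
  have hm : ∀ i ∈ List.range' a (b + 1 - a), a * w ≤ i * w ∧ i * w ≤ b * w := fun i hi => by
    rw [List.mem_range'_1] at hi
    exact ⟨hle (by omega), hle (by omega)⟩
  have e1 : expand n N hN (blockProd n w 0 (w - 1) a (b + 1 - a)) =
      ((List.range' a (b + 1 - a)).map fun i =>
        gen N (2 * (i * w)) (2 * (i * w + (w - 1)) + 1)).prod *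
      ((List.range' a (b + 1 - a)).map fun i => pairs N (i * w) (i * w + (w - 1))).prod := by
    rw [prod_map_mul_of_commute _ _ _ List.nodup_range', blockProd, map_list_prod, List.map_map]
    · refine congrArg List.prod (List.map_congr_left fun i hi => ?_)
      have := hm i hi
      exact expand_gen hN (by omega) (by omega)
    · intro i _ j _ hij
      refine (show Commute (pairs N (j * w) (j * w + (w - 1))) _ from
        pairs_gen_commute _ _ _ _ _ ?_).symm
      rcases lt_or_gt_of_ne hij with h | h
      · have := hle (Nat.succ_le_of_lt h)
        rw [Nat.succ_mul] at this
        omega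
      · have := hle (Nat.succ_le_of_lt h)
        rw [Nat.succ_mul] at this
        omega
  have e2 : blockProd N 2 0 1 (a * w) ((b + 1 - a) * w) =
      pairs N (a * w) (b * w + (w - 1)) := by
    rw [pairs_eq_blockProd, Nat.sub_mul, Nat.succ_mul]
    congr 1
    omega
  have hc : Commute (pairs N (a * w) (b * w + (w - 1)))
      ((List.range' a (b + 1 - a)).map fun i =>
        gen N (2 * (i * w)) (2 * (i * w + (w - 1)) + 1)).prod := by
    refine Commute.list_prod_right _ _ fun x hx => ?_
    obtain ⟨i, hi, rfl⟩ := List.mem_map.1 hx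
    have := hm i hi
    exact (gen_pairs_commute_of_le N _ _ _ _ (by omega) (by omega) (by omega) (by omega)).symm
  rw [map_mul, expand_gen hN (by omega) (by omega), e1, prod_pairs_blocks _ _ _ _ hw, e2,
    mul_assoc, ← mul_assoc (pairs _ _ _), hc.eq, mul_assoc, pairs_sq, mul_one]
  congr 1
  · congr 1
    · ring
    · have : b * (2 * w) = 2 * (b * w) := by ring
      omega
  · refine congrArg List.prod (List.map_congr_left fun i _ => ?_)
    have : i * (2 * w) = 2 * (i * w) := by ring
    congr 1 <;> omega

theorem expIter_gen (k l : ℕ) {a b : ℕ} (hab : a ≤ b) (hb : b < 2 ^ k) :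
    expIter k l (gen (2 ^ k) a b) =
      gen (2 ^ (k + l)) (a * 2 ^ l) (b * 2 ^ l + (2 ^ l - 1)) *
        blockProd (2 ^ (k + l)) (2 ^ l) 0 (2 ^ l - 1) a (b + 1 - a) := by
  induction l with
  | zero =>
    have : blockProd (2 ^ (k + 0)) (2 ^ 0) 0 (2 ^ 0 - 1) a (b + 1 - a) = 1 :=
      List.prod_eq_one fun x hx => by
        obtain ⟨i, -, rfl⟩ := List.mem_map.1 hx
        exact gen_of_le (by simp)
    rw [this, mul_one]
    simp [expIter]
  | succ l ih =>
    have := expand_cable (n := 2 ^ (k + l)) (N := 2 ^ (k + (l + 1))) (w := 2 ^ l)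
      (pow_succ' 2 (k + l)) (by positivity) hab
      (by rw [pow_add]; exact Nat.mul_le_mul_right _ hb)
    rw [expIter, MonoidHom.comp_apply, ih, pow_succ' 2 l]
    exact this

theorem cable_commute_blockProd {N w a b c d m : ℕ} (hab : a ≤ b) (hbm : b < m)
    (hm : m * w ≤ N) (hcd : c < d) (hd : d < w) :
    Commute (gen N (a * w) (b * w + (w - 1)) * blockProd N w 0 (w - 1) a (b + 1 - a))
      (blockProd N w c d 0 m) := by
  have hle : ∀ {i j : ℕ}, i ≤ j → i * w ≤ j * w := fun h => Nat.mul_le_mul_right w h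
  have hsucc : ∀ {i j : ℕ}, i < j → i * w + w ≤ j * w := fun h => by
    have := hle (Nat.succ_le_of_lt h)
    rwa [Nat.succ_mul] at this
  have hb := hsucc hbm
  let ρ : ℕ → ℕ := fun i => if a ≤ i ∧ i ≤ b then a + b - i else i
  have hconj : ∀ i ∈ List.range' 0 m,
      (gen N (a * w) (b * w + (w - 1)) * blockProd N w 0 (w - 1) a (b + 1 - a)) *
        gen N (i * w + c) (i * w + d) = gen N (ρ i * w + c) (ρ i * w + d) *
      (gen N (a * w) (b * w + (w - 1)) * blockProd N w 0 (w - 1) a (b + 1 - a)) := by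
    intro i _
    by_cases hi : a ≤ i ∧ i ≤ b
    · have h1 := hle hi.1
      have h2 := hle hi.2
      have e1 : blockProd N w 0 (w - 1) a (b + 1 - a) * gen N (i * w + c) (i * w + d) =
          gen N (i * w + (w - 1 - d)) (i * w + (w - 1 - c)) *
            blockProd N w 0 (w - 1) a (b + 1 - a) := by
        refine prod_map_conj_single _ _ _ _ List.nodup_range' i
          (List.mem_range'_1.2 (by omega)) ?_ fun j _ hj =>
            ⟨gen_blocks_commute (by omega) hd hj, gen_blocks_commute (by omega) (by omega) hj⟩
        rw [gen_nested _ _ _ _ _ (by omega) (by omega) (by omega) (by omega)]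
        congr 2 <;> omega
      have e2 : (a + b - i) * w = a * w + b * w - i * w := by
        rw [Nat.sub_mul, Nat.add_mul]
      rw [mul_assoc, e1, ← mul_assoc,
        gen_nested _ _ _ _ _ (by omega) (by omega) (by omega) (by omega), mul_assoc]
      simp only [ρ, if_pos hi, e2]
      congr 2 <;> omega
    · simp only [ρ, if_neg hi]
      refine Commute.eq (Commute.mul_left (gen_separated _ _ _ _ _ ?_)
        (Commute.list_prod_left _ _ fun x hx => ?_))
      · rcases lt_or_ge i a with h | h
        · have := hsucc h
          omega
        · have := hsucc (show b < i by omega)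
          omega
      · obtain ⟨j, hj, rfl⟩ := List.mem_map.1 hx
        rw [List.mem_range'_1] at hj
        exact gen_blocks_commute (by omega) hd (by rintro rfl; omega)
  have hperm : ((List.range' 0 m).map ρ).Perm (List.range' 0 m) := by
    have hρ : ∀ x, ρ (ρ x) = x := fun x => by
      simp only [ρ]
      split_ifs <;> omega
    have hρm : ∀ x, x < m → ρ x < m := fun x hx => by
      simp only [ρ]
      split_ifs <;> omega
    rw [List.perm_ext_iff_of_nodup 
      (List.Nodup.map (Function.LeftInverse.injective hρ) List.nodup_range')
      List.nodup_range']
    intro x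
    simp only [List.mem_map, List.mem_range'_1]
    constructor
    · rintro ⟨y, hy, rfl⟩
      have := hρm y (by omega)
      omega
    · intro hx
      have := hρm x (by omega)
      exact ⟨ρ x, by omega, hρ x⟩
  have h1 := prod_map_conj _ _ _ _ hconj
  have h2 : ((List.range' 0 m).map fun i => gen N (ρ i * w + c) (ρ i * w + d)).prod =
      blockProd N w c d 0 m := by
    have := hperm.map fun i => gen N (i * w + c) (i * w + d)
    rw [List.map_map] at this
    refine this.prod_eq' (List.pairwise_map.2 (List.pairwise_of_forall fun i j => ?_))
    exact gen_blocks_commute_self hd _ _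
  rw [h2] at h1
  exact h1

theorem two_pow_add (k l : ℕ) : 2 ^ (k + l) = 2 ^ k * 2 ^ l := pow_add 2 k l

theorem expIter_commute_copies (k l : ℕ) (a : J (2 ^ k)) (b : J (2 ^ l)) :
    Commute (expIter k l a) (copies (2 ^ l) (2 ^ (k + l)) (2 ^ k) (two_pow_add k l) b) := by
  refine J.commute_of_gen _ _ (fun i j hij hj => ?_) a
  refine (J.commute_of_gen _ _ (fun c d hcd hd => ?_) b).symm
  rw [expIter_gen k l hij.le hj, copies_gen _ hd]
  exact (cable_commute_blockProd hij.le hj (pow_add 2 k l).ge hcd hd).symm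

/-- The homomorphism `J_{2^k} × J_{2^l} → J_{2^(k+l)}` that lifts the wreath product. -/
def wreathJ (k l : ℕ) : J (2 ^ k) × J (2 ^ l) →* J (2 ^ (k + l)) :=
  (expIter k l).noncommCoprod (copies (2 ^ l) (2 ^ (k + l)) (2 ^ k) (two_pow_add k l))
    (expIter_commute_copies k l)

theorem wreathJ_apply (k l : ℕ) (a : J (2 ^ k)) (b : J (2 ^ l)) :
    wreathJ k l (a, b) = expIter k l a *
      copies (2 ^ l) (2 ^ (k + l)) (2 ^ k) (two_pow_add k l) b := rfl

theorem expand_copies {n N c n' N' : ℕ} (hN : N = c * n) (hn' : n' = 2 * n) (hN' : N' = 2 * N)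
    (h : N' = c * n') (x : J n) :
    expand N N' hN' (copies n N c hN x) = copies n' N' c h (expand n n' hn' x) := by
  suffices H : (expand N N' hN').comp (copies n N c hN) =
      (copies n' N' c h).comp (expand n n' hn') from DFunLike.congr_fun H x
  refine J.hom_ext fun a b hab hb => ?_
  have e1 : copies n' N' c h (pairs n' a b) =
      ((List.range' 0 c).map fun i => pairs N' (i * n + a) (i * n + b)).prod := by
    rw [pairs, map_list_prod, List.map_map]
    have e : (List.range' a (b + 1 - a)).map
        (copies n' N' c h ∘ fun r => gen n' (2 * r) (2 * r + 1)) =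
        (List.range' a (b + 1 - a)).map fun r => ((List.range' 0 c).map fun i =>
          gen N' (i * n' + 2 * r) (i * n' + (2 * r + 1))).prod :=
      List.map_congr_left fun r hr => by
        rw [List.mem_range'_1] at hr
        exact copies_gen h (by omega)
    rw [e, prod_map_prod_comm _ _ List.nodup_range']
    · refine congrArg List.prod (List.map_congr_left fun i _ => ?_)
      have : (List.range' (i * n + a) (i * n + b + 1 - (i * n + a))) =
          (List.range' a (b + 1 - a)).map (i * n + ·) := by
        rw [List.map_add_range']
        congr 1
        omega
      rw [pairs, this, List.map_map]
      refine congrArg List.prod (List.map_congr_left fun r _ => ?_)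
      have : i * n' = 2 * (i * n) := by rw [hn']; ring
      simp only [Function.comp_apply]
      congr 1 <;> omega
    · intro i _ j _ hij r hr r' hr'
      rw [List.mem_range'_1] at hr hr'
      exact gen_blocks_commute (by omega) (by omega) hij
  rw [MonoidHom.comp_apply, MonoidHom.comp_apply, copies_gen hN hb, expand_gen hn' hab.le hb,
    map_mul, copies_gen h (by omega), e1, blockProd, blockProd,
    prod_map_mul_of_commute _ _ _ List.nodup_range', map_list_prod, List.map_map]
  · refine congrArg List.prod (List.map_congr_left fun i hi => ?_)
    rw [List.mem_range'_1] at hi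
    have hlt := block_lt (i := i) (c := c) (by omega) hb
    have e2 : i * n' = 2 * (i * n) := by rw [hn']; ring
    rw [Function.comp_apply, expand_gen hN' (by omega) (by omega), e2]
    congr 2 <;> omega
  · intro i _ j _ hij
    refine Commute.list_prod_right _ _ fun x hx => ?_
    obtain ⟨r, hr, rfl⟩ := List.mem_map.1 hx
    rw [List.mem_range'_1] at hr
    have e2 : j * n' = 2 * (j * n) := by rw [hn']; ring
    have e3 : gen N' (2 * r) (2 * r + 1) =
        gen N' (j * n' + (2 * r - j * n')) (j * n' + (2 * r + 1 - j * n')) := by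
      congr 1 <;> omega
    rw [e3]
    exact gen_blocks_commute (by omega) (by omega) hij

theorem expIter_copies (k l m : ℕ) (h : 2 ^ (k + l + m) = 2 ^ k * 2 ^ (l + m)) (b : J (2 ^ l)) :
    expIter (k + l) m (copies (2 ^ l) (2 ^ (k + l)) (2 ^ k) (two_pow_add k l) b) =
      copies (2 ^ (l + m)) (2 ^ (k + l + m)) (2 ^ k) h (expIter l m b) := by
  induction m with
  | zero => rfl
  | succ m ih =>
    have h' : 2 ^ (k + l + m) = 2 ^ k * 2 ^ (l + m) := by rw [add_assoc, pow_add]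
    rw [expIter, MonoidHom.comp_apply, ih h']
    exact expand_copies _ (pow_succ' 2 (l + m)) _ _ _

theorem copies_copies {n N N' c c' : ℕ} (hN : N = c * n) (hN' : N' = c' * N)
    (h : N' = c' * c * n) (x : J n) :
    copies N N' c' hN' (copies n N c hN x) = copies n N' (c' * c) h x := by
  suffices H : (copies N N' c' hN').comp (copies n N c hN) = copies n N' (c' * c) h from
    DFunLike.congr_fun H x
  refine J.hom_ext fun a b hab hb => ?_
  have hlt : ∀ i ∈ List.range' 0 c, i * n + b < N := fun i hi => by
    rw [List.mem_range'_1] at hi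
    rw [hN]
    exact block_lt (by omega) hb
  rw [MonoidHom.comp_apply, copies_gen hN hb, copies_gen h hb, blockProd, map_list_prod,
    List.map_map]
  have e : (List.range' 0 c).map
      (copies N N' c' hN' ∘ fun i => gen N (i * n + a) (i * n + b)) =
      (List.range' 0 c).map fun i => ((List.range' 0 c').map fun j =>
        gen N' (j * N + (i * n + a)) (j * N + (i * n + b))).prod :=
    List.map_congr_left fun i hi => copies_gen hN' (hlt i hi)
  rw [e, prod_map_prod_comm _ _ List.nodup_range' _ fun i _ j _ hij r hr r' hr' =>
    gen_blocks_commute (hlt r hr) (hlt r' hr') hij]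
  have key : ∀ m, ((List.range' 0 m).map fun j => ((List.range' 0 c).map fun i =>
      gen N' (j * N + (i * n + a)) (j * N + (i * n + b))).prod).prod =
      blockProd N' n a b 0 (m * c) := by
    intro m
    induction m with
    | zero => simp [blockProd]
    | succ m ih =>
      rw [List.range'_1_concat, List.map_append, List.prod_append, ih, Nat.succ_mul,
        blockProd_add, List.map_singleton, List.prod_singleton, blockProd, blockProd]
      congr 2
      have : List.range' (0 + m * c) c = (List.range' 0 c).map (m * c + ·) := by
        rw [List.map_add_range', add_comm]
      rw [this, List.map_map]
      refine List.map_congr_left fun i _ => ?_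
      simp only [Function.comp_apply, zero_add, hN, Nat.add_mul, Nat.mul_assoc, Nat.add_assoc]
  exact key c'

/-- The transport of `J_{2^k}` along an equality of exponents. -/
def castJ {k k' : ℕ} (h : k = k') : J (2 ^ k) →* J (2 ^ k') := h ▸ MonoidHom.id _

theorem castJ_gen {k k' : ℕ} (h : k = k') (a b : ℕ) :
    castJ h (gen (2 ^ k) a b) = gen (2 ^ k') a b := by
  subst h
  rfl

theorem castJ_expTwo {k k' : ℕ} (h : k = k') (h' : k + 1 = k' + 1) (x : J (2 ^ k)) :
    castJ h' (expTwo k x) = expTwo k' (castJ h x) := by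
  subst h
  rfl

theorem castJ_copies {k k' n c : ℕ} (h : k = k') (h1 : 2 ^ k = c * n) (h2 : 2 ^ k' = c * n)
    (x : J n) : castJ h (copies n (2 ^ k) c h1 x) = copies n (2 ^ k') c h2 x := by
  subst h
  rfl

theorem copies_congr {n N c c' : ℕ} (h : c = c') (h1 : N = c * n) (h2 : N = c' * n) (x : J n) :
    copies n N c h1 x = copies n N c' h2 x := by
  subst h
  rfl

theorem expIter_expIter (k l m : ℕ) (x : J (2 ^ k)) :
    castJ (add_assoc k l m) (expIter (k + l) m (expIter k l x)) = expIter k (l + m) x := by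
  induction m with
  | zero => rfl
  | succ m ih =>
    rw [expIter, MonoidHom.comp_apply]
    refine (castJ_expTwo (add_assoc k l m) (add_assoc k l (m + 1)) _).trans ?_
    rw [ih]
    rfl

theorem wreathJ_assoc (k l m : ℕ) (a : J (2 ^ k)) (b : J (2 ^ l)) (c : J (2 ^ m)) :
    castJ (add_assoc k l m) (wreathJ (k + l) m (wreathJ k l (a, b), c)) =
      wreathJ k (l + m) (a, wreathJ l m (b, c)) := by
  have h : 2 ^ (k + l + m) = 2 ^ k * 2 ^ (l + m) := by rw [add_assoc, pow_add]
  have h' : 2 ^ (k + (l + m)) = 2 ^ k * 2 ^ l * 2 ^ m := by rw [pow_add, pow_add, mul_assoc]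
  have h'' : 2 ^ (k + (l + m)) = 2 ^ (k + l) * 2 ^ m := by rw [pow_add, pow_add, pow_add, mul_assoc]
  simp only [wreathJ_apply, map_mul]
  rw [expIter_expIter, expIter_copies k l m h, castJ_copies _ h (two_pow_add _ _),
    castJ_copies _ _ h'', copies_copies _ _ h', copies_congr (two_pow_add k l) h'' h', mul_assoc]

theorem wreathJ_one_left (l : ℕ) (b : J (2 ^ l)) :
    castJ (zero_add l) (wreathJ 0 l (1, b)) = b := by
  suffices H : (castJ (zero_add l)).comp (copies (2 ^ l) (2 ^ (0 + l)) (2 ^ 0) (two_pow_add 0 l)) =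
      MonoidHom.id _ by
    rw [wreathJ_apply, map_one, one_mul]
    exact DFunLike.congr_fun H b
  refine J.hom_ext fun a b _ hb => ?_
  rw [MonoidHom.comp_apply, copies_gen _ hb]
  simp [blockProd, castJ_gen]

theorem phi_gen_val {N a b : ℕ} (hab : a ≤ b) (hb : b < N) (x : Fin N) :
    (phi N (gen N a b) x).1 = if a ≤ x.1 ∧ x.1 ≤ b then a + b - x.1 else x.1 := by
  rcases hab.lt_or_eq with hab | rfl
  · have : gen N a b = alpha ⟨a, b, hab, hb⟩ := dif_pos ⟨hab, hb⟩
    rw [this, phi, J.lift_alpha]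
    exact Interval.flip_val _ x
  · rw [gen_of_le le_rfl, map_one, Equiv.Perm.one_apply]
    split_ifs <;> omega

theorem phi_blockProd_val {N w c d : ℕ} (hcd : c ≤ d) (hd : d < w) (m s : ℕ)
    (hm : (s + m) * w ≤ N) (x : Fin N) (i j : ℕ) (hj : j < w) (hx : x.1 = i * w + j) :
    (phi N (blockProd N w c d s m) x).1 =
      if (s ≤ i ∧ i < s + m) ∧ c ≤ j ∧ j ≤ d then i * w + (c + d - j) else i * w + j := by
  induction m generalizing s with
  | zero =>
    rw [if_neg (by omega), ← hx]
    rfl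
  | succ m ih =>
    have ih := ih (s + 1) (by rwa [show s + 1 + m = s + (m + 1) by ring])
    have e : blockProd N w c d s (m + 1) =
        gen N (s * w + c) (s * w + d) * blockProd N w c d (s + 1) m := by
      rw [blockProd, List.range'_succ, List.map_cons, List.prod_cons, blockProd]
    have hs : s * w + d < N := lt_of_lt_of_le (block_lt (c := s + (m + 1)) (by omega) hd) hm
    rw [e, map_mul, Equiv.Perm.mul_apply, phi_gen_val (by omega) hs, ih]
    rcases lt_trichotomy i s with h | rfl | h
    · have := block_lt h hj
      have := block_lt (a := w - 1) (n := w) h (by omega)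
      split_ifs <;> omega
    · split_ifs <;> omega
    · have := block_lt h hd
      split_ifs <;> omega

theorem wreath_val (k l : ℕ) (σ : Equiv.Perm (Fin (2 ^ k))) (τ : Equiv.Perm (Fin (2 ^ l)))
    (i : Fin (2 ^ k)) (j : Fin (2 ^ l)) :
    (wreath k l (σ, τ) (blocks k l (i, j))).1 = (σ i).1 * 2 ^ l + (τ j).1 := by
  have : wreath k l (σ, τ) (blocks k l (i, j)) = blocks k l (σ i, τ j) := by
    simp [wreath, Equiv.permCongr_apply]
  rw [this, blocks_val]

theorem phi_expIter (k l : ℕ) (a : J (2 ^ k)) :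
    phi (2 ^ (k + l)) (expIter k l a) = wreath k l (phi (2 ^ k) a, 1) := by
  suffices H : (phi (2 ^ (k + l))).comp (expIter k l) =
      (wreath k l).comp ((MonoidHom.inl _ _).comp (phi (2 ^ k))) from DFunLike.congr_fun H a
  refine J.hom_ext fun a b hab hb => Equiv.ext fun x => Fin.ext ?_
  obtain ⟨⟨i, j⟩, rfl⟩ := (blocks k l).surjective x
  have hw : (b + 1) * 2 ^ l ≤ 2 ^ (k + l) := by
    rw [pow_add]
    exact Nat.mul_le_mul_right _ hb
  have hbN : b * 2 ^ l + (2 ^ l - 1) < 2 ^ (k + l) := by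
    have := Nat.two_pow_pos l
    rw [Nat.succ_mul] at hw
    omega
  have hw' : (a + (b + 1 - a)) * 2 ^ l ≤ 2 ^ (k + l) := by
    rwa [show a + (b + 1 - a) = b + 1 by omega]
  have hle : ∀ {i j : ℕ}, i ≤ j → i * 2 ^ l ≤ j * 2 ^ l := fun h => Nat.mul_le_mul_right _ h
  have hj := j.2
  refine Eq.trans ?_ (wreath_val k l (phi (2 ^ k) (gen (2 ^ k) a b)) 1 i j).symm
  rw [MonoidHom.comp_apply, expIter_gen k l hab.le hb, map_mul, Equiv.Perm.mul_apply,
    phi_gen_val (by have := hle hab.le; omega) hbN, phi_gen_val hab.le hb,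
    phi_blockProd_val (by omega) (by omega) _ _ hw' _ i j hj (blocks_val k l _),
    Equiv.Perm.one_apply]
  by_cases h : a ≤ i.1 ∧ i.1 ≤ b
  · have h1 := hle h.1
    have h2 := hle h.2
    have e : (a + b - i.1) * 2 ^ l = a * 2 ^ l + b * 2 ^ l - i.1 * 2 ^ l := by
      rw [Nat.sub_mul, Nat.add_mul]
    rw [if_pos h, e]
    split_ifs <;> omega
  · rw [if_neg h]
    rcases lt_or_ge i.1 a with h3 | h3
    · have := block_lt h3 hj
      split_ifs <;> omega
    · have := block_lt (a := 2 ^ l - 1) (n := 2 ^ l) (show b < i.1 by omega) (by omega)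
      split_ifs <;> omega

theorem phi_copies (k l : ℕ) (b : J (2 ^ l)) :
    phi (2 ^ (k + l)) (copies (2 ^ l) (2 ^ (k + l)) (2 ^ k) (two_pow_add k l) b) =
      wreath k l (1, phi (2 ^ l) b) := by
  suffices H : (phi (2 ^ (k + l))).comp
      (copies (2 ^ l) (2 ^ (k + l)) (2 ^ k) (two_pow_add k l)) =
      (wreath k l).comp ((MonoidHom.inr _ _).comp (phi (2 ^ l))) from DFunLike.congr_fun H b
  refine J.hom_ext fun a b hab hb => Equiv.ext fun x => Fin.ext ?_
  obtain ⟨⟨i, j⟩, rfl⟩ := (blocks k l).surjective x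
  refine Eq.trans ?_ (wreath_val k l 1 (phi (2 ^ l) (gen (2 ^ l) a b)) i j).symm
  rw [MonoidHom.comp_apply, copies_gen _ hb, phi_gen_val hab.le hb,
    phi_blockProd_val hab.le hb _ _ (by rw [zero_add, pow_add]) _ i j j.2 (blocks_val k l _),
    Equiv.Perm.one_apply]
  have := i.2
  split_ifs <;> omega

theorem phi_wreathJ (k l : ℕ) (a : J (2 ^ k)) (b : J (2 ^ l)) :
    phi (2 ^ (k + l)) (wreathJ k l (a, b)) = wreath k l (phi (2 ^ k) a, phi (2 ^ l) b) := by
  rw [wreathJ_apply, map_mul, phi_expIter, phi_copies, ← map_mul, Prod.mk_mul_mk, mul_one, one_mul]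

theorem wreathJ_one_right (k l : ℕ) (a : J (2 ^ k)) : wreathJ k l (a, 1) = expIter k l a := by
  rw [wreathJ_apply, map_one, mul_one]

theorem wreathJ_one_gen (k l a b : ℕ) (hb : b < 2 ^ l) :
    wreathJ k l (1, gen (2 ^ l) a b) = ((List.range (2 ^ k)).map fun i =>
      gen (2 ^ (k + l)) (i * 2 ^ l + a) (i * 2 ^ l + b)).prod := by
  rw [wreathJ_apply, map_one, one_mul, copies_gen _ hb, blockProd, List.range_eq_range']

theorem B_map_comp {G H K : Type} [Group G] [Group H] [Group K] (f : G →* H) (g : H →* K)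
    (z : B.obj (GrpCat.of G)) :
    B.map (GrpCat.ofHom g) (B.map (GrpCat.ofHom f) z) = B.map (GrpCat.ofHom (g.comp f)) z := by
  rw [GrpCat.ofHom_comp, B.map_comp]
  rfl

theorem B_map_id {G : Type} [Group G] (z : B.obj (GrpCat.of G)) :
    B.map (GrpCat.ofHom (MonoidHom.id G)) z = z := by
  rw [GrpCat.ofHom_id, B.map_id]
  rfl

/-- The trivial homomorphism induces the constant map to the base point. -/
theorem B_map_one {G H : Type} [Group G] [Group H] (z : B.obj (GrpCat.of G)) :
    B.map (GrpCat.ofHom (1 : G →* H)) z = basePoint (GrpCat.of H) := by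
  obtain ⟨n, x, s, rfl⟩ := Realization.exists_point (X := groupNerve.obj (GrpCat.of G)) z
  let v : (groupNerve.obj (GrpCat.of H)).obj (op (.mk 0)) := nerveEquiv.symm (SingleObj.star H)
  let f : n ⟶ .mk 0 := SimplexCategory.const _ _ 0
  have h1 : (groupNerve.map (GrpCat.ofHom (1 : G →* H))).app (op n) x =
      (groupNerve.obj (GrpCat.of H)).map f.op v := by
    apply (groupNerveEquiv (GrpCat.of H) (op n)).injective
    funext i
    rw [groupNerveEquiv_map]
    rfl
  refine (Realization.toTop_map_point (groupNerve.map (GrpCat.ofHom (1 : G →* H))) x s).trans ?_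
  rw [h1, Realization.point_map]
  exact congrArg (Realization.point v) (Subsingleton.elim _ _)

/-- `B` commutes with products of countable groups. -/
noncomputable def homeomorphBProd (G H : Type) [Group G] [Group H] [Countable G] [Countable H] :
    B.obj (GrpCat.of (G × H)) ≃ₜ B.obj (GrpCat.of G) × B.obj (GrpCat.of H) :=
  (isHomeomorph_B_prod G H).homeomorph

theorem homeomorphBProd_symm {G H K : Type} [Group G] [Group H] [Group K] [Countable G]
    [Countable H] (f : K →* G) (g : K →* H) (z : B.obj (GrpCat.of K)) :
    (homeomorphBProd G H).symm (B.map (GrpCat.ofHom f) z, B.map (GrpCat.ofHom g) z) =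
      B.map (GrpCat.ofHom (f.prod g)) z := by
  rw [Homeomorph.symm_apply_eq]
  refine Prod.ext (Eq.symm ?_) (Eq.symm ?_)
  · exact B_map_comp _ _ _
  · exact B_map_comp _ _ _

/-- The multiplication of `M_J` induced by the homomorphisms `wreathJ k l`. -/
@[reducible] noncomputable def MJ.instMul : Mul MJ where
  mul x y := ⟨x.1 + y.1, B.map (GrpCat.ofHom (wreathJ x.1 y.1))
    ((homeomorphBProd (J (2 ^ x.1)) (J (2 ^ y.1))).symm (x.2, y.2))⟩

section

attribute [local instance] MJ.instMul

theorem MJ.mk_mul_mk {k l : ℕ} {G : Type} [Group G] (f : G →* J (2 ^ k)) (g : G →* J (2 ^ l))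
    (z : B.obj (GrpCat.of G)) :
    (⟨k, B.map (GrpCat.ofHom f) z⟩ : MJ) * ⟨l, B.map (GrpCat.ofHom g) z⟩ =
      ⟨k + l, B.map (GrpCat.ofHom ((wreathJ k l).comp (f.prod g))) z⟩ := by
  refine congrArg (Sigma.mk (k + l)) ?_
  dsimp only
  rw [homeomorphBProd_symm, B_map_comp]

theorem MJ.mk_fst_mul_mk_snd (k l : ℕ) (z : B.obj (GrpCat.of (J (2 ^ k) × J (2 ^ l)))) :
    (⟨k, B.map (GrpCat.ofHom (MonoidHom.fst _ _)) z⟩ : MJ) *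
        ⟨l, B.map (GrpCat.ofHom (MonoidHom.snd _ _)) z⟩ =
      ⟨k + l, B.map (GrpCat.ofHom (wreathJ k l)) z⟩ := by
  rw [MJ.mk_mul_mk]
  have : (wreathJ k l).comp ((MonoidHom.fst _ _).prod (MonoidHom.snd _ _)) = wreathJ k l :=
    MonoidHom.ext fun _ => rfl
  rw [this]

theorem MJ.mk_eq {k k' : ℕ} (h : k = k') (z : B.obj (GrpCat.of (J (2 ^ k)))) :
    (⟨k, z⟩ : MJ) = ⟨k', B.map (GrpCat.ofHom (castJ h)) z⟩ := by
  subst h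
  exact congrArg (Sigma.mk k) (B_map_id z).symm

theorem MJ.mul_assoc (x y z : MJ) : x * y * z = x * (y * z) := by
  obtain ⟨k, x⟩ := x
  obtain ⟨l, y⟩ := y
  obtain ⟨m, z⟩ := z
  obtain ⟨t, ht⟩ := (homeomorphBProd (J (2 ^ k)) (J (2 ^ l))).surjective (x, y)
  obtain ⟨s, hs⟩ := (homeomorphBProd (J (2 ^ k) × J (2 ^ l)) (J (2 ^ m))).surjective (t, z)
  obtain ⟨hx, hy⟩ := Prod.ext_iff.1 ht
  obtain ⟨ht, hz⟩ := Prod.ext_iff.1 hs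
  have hx : B.map (GrpCat.ofHom ((MonoidHom.fst _ _).comp (MonoidHom.fst _ _))) s = x := by
    rw [← B_map_comp]
    exact (congrArg _ ht).trans hx
  have hy : B.map (GrpCat.ofHom ((MonoidHom.snd _ _).comp (MonoidHom.fst _ _))) s = y := by
    rw [← B_map_comp]
    exact (congrArg _ ht).trans hy
  have hz : B.map (GrpCat.ofHom (MonoidHom.snd _ _)) s = z := hz
  rw [← hx, ← hy, ← hz, MJ.mk_mul_mk, MJ.mk_mul_mk, MJ.mk_mul_mk, MJ.mk_mul_mk,
    MJ.mk_eq (add_assoc k l m), B_map_comp]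
  refine congrArg (fun f => (⟨k + (l + m), B.map (GrpCat.ofHom f) s⟩ : MJ)) ?_
  exact MonoidHom.ext fun p => wreathJ_assoc k l m _ _ _

end

/-- The monoid `M_J`. -/
@[reducible] noncomputable def MJ.instMonoid : Monoid MJ where
  toMul := MJ.instMul
  one := ⟨0, basePoint _⟩
  mul_assoc := MJ.mul_assoc
  one_mul x := by
    obtain ⟨k, x⟩ := x
    have h1 : (⟨0, basePoint _⟩ : MJ) = ⟨0, B.map (GrpCat.ofHom (1 : J (2 ^ k) →* _)) x⟩ :=
      congrArg (Sigma.mk 0) (B_map_one x).symm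
    have h2 := MJ.mk_mul_mk (1 : J (2 ^ k) →* J (2 ^ 0)) (MonoidHom.id (J (2 ^ k))) x
    rw [← h1, B_map_id, MJ.mk_eq (zero_add k), B_map_comp] at h2
    refine h2.trans (congrArg (Sigma.mk k) (Eq.trans ?_ (B_map_id x)))
    refine congrArg (fun f => B.map (GrpCat.ofHom f) x) ?_
    exact MonoidHom.ext fun p => wreathJ_one_left k p
  mul_one x := by
    obtain ⟨k, x⟩ := x
    have h1 : (⟨0, basePoint _⟩ : MJ) = ⟨0, B.map (GrpCat.ofHom (1 : J (2 ^ k) →* _)) x⟩ :=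
      congrArg (Sigma.mk 0) (B_map_one x).symm
    have h2 := MJ.mk_mul_mk (MonoidHom.id (J (2 ^ k))) (1 : J (2 ^ k) →* J (2 ^ 0)) x
    rw [← h1, B_map_id] at h2
    refine h2.trans (congrArg (Sigma.mk k) (Eq.trans ?_ (B_map_id x)))
    refine congrArg (fun f => B.map (GrpCat.ofHom f) x) ?_
    exact MonoidHom.ext fun p => wreathJ_one_right k 0 p

attribute [local instance] MJ.instMonoid

theorem MJ.instContinuousMul : ContinuousMul MJ where
  continuous_mul := by
    rw [continuous_iff_continuousAt]
    rintro ⟨⟨k, x⟩, ⟨l, y⟩⟩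
    rw [ContinuousAt, nhds_prod_eq, Sigma.nhds_mk, Sigma.nhds_mk, Filter.prod_map_map_eq,
      ← nhds_prod_eq, Filter.tendsto_map'_iff]
    have h : Continuous fun p : B.obj (GrpCat.of (J (2 ^ k))) × B.obj (GrpCat.of (J (2 ^ l))) =>
        (⟨k + l, B.map (GrpCat.ofHom (wreathJ k l))
          ((homeomorphBProd (J (2 ^ k)) (J (2 ^ l))).symm p)⟩ : MJ) :=
      continuous_sigmaMk.comp ((B.map (GrpCat.ofHom (wreathJ k l))).hom.continuous.comp
        (homeomorphBProd (J (2 ^ k)) (J (2 ^ l))).symm.continuous)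
    exact h.tendsto (x, y)

theorem MJ.mk_mul_idTwo (k : ℕ) (x : B.obj (GrpCat.of (J (2 ^ k)))) :
    (⟨k, x⟩ : MJ) * idTwo = ⟨k + 1, B.map (GrpCat.ofHom (expTwo k)) x⟩ := by
  have h1 : idTwo = ⟨1, B.map (GrpCat.ofHom (1 : J (2 ^ k) →* J (2 ^ 1))) x⟩ :=
    congrArg (Sigma.mk 1) (B_map_one x).symm
  have h2 := MJ.mk_mul_mk (MonoidHom.id (J (2 ^ k))) (1 : J (2 ^ k) →* J (2 ^ 1)) x
  rw [← h1, B_map_id] at h2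
  refine h2.trans (congrArg (Sigma.mk (k + 1))
    (congrArg (fun f => B.map (GrpCat.ofHom f) x) ?_))
  exact MonoidHom.ext fun p => wreathJ_one_right k 1 p

section Telescope

variable {M : Type} [TopologicalSpace M] [Monoid M] [ContinuousMul M] {p : M}

theorem telescope_ι_succ {c : Cocone (telescope M p)} (i : ℕ) (x : M) :
    c.ι.app (i + 1) (x * p : M) = c.ι.app i x := by
  have h := c.w (homOfLE (Nat.le_add_right i 1))
  have h' : (telescope M p).map (homOfLE (Nat.le_add_right i 1)) =
      TopCat.ofHom ⟨fun x => x * p, continuous_mul_const p⟩ :=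
    Functor.ofSequence_map_homOfLE_succ _ i
  rw [h'] at h
  exact ConcreteCategory.congr_hom h x

theorem telescope_ι_pow {c : Cocone (telescope M p)} (i j : ℕ) (x : M) :
    c.ι.app (i + j) (x * p ^ j : M) = c.ι.app i x := by
  induction j with
  | zero =>
    rw [pow_zero, mul_one]
    rfl
  | succ j ih => rw [pow_succ, ← mul_assoc, ← ih, ← telescope_ι_succ (i + j)]; rfl

/-- A cocone over the telescope from maps compatible with multiplication by `p`. -/
def telescopeCocone {T : Type} [TopologicalSpace T] (f : ℕ → C(M, T))
    (hf : ∀ i x, f (i + 1) (x * p) = f i x) : Cocone (telescope M p) where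
  pt := TopCat.of T
  ι := NatTrans.ofSequence (fun i => TopCat.ofHom (f i)) fun i => by
    have h' : (telescope M p).map (homOfLE (Nat.le_add_right i 1)) =
        TopCat.ofHom ⟨fun x => x * p, continuous_mul_const p⟩ :=
      Functor.ofSequence_map_homOfLE_succ _ i
    rw [h']
    ext x
    exact hf i x

end Telescope

theorem toJinf_expTwo (k : ℕ) (x : B.obj (GrpCat.of (J (2 ^ k)))) :
    B.map (toJinf (k + 1)) (B.map (GrpCat.ofHom (expTwo k)) x) = B.map (toJinf k) x := by
  have h := (GrpCat.FilteredColimits.colimitCocone sequenceJ).w (homOfLE (Nat.le_add_right k 1))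
  have h' : sequenceJ.map (homOfLE (Nat.le_add_right k 1)) = GrpCat.ofHom (expTwo k) :=
    Functor.ofSequence_map_homOfLE_succ _ k
  rw [h'] at h
  exact ConcreteCategory.congr_hom ((B.map_comp _ _).symm.trans (congrArg B.map h)) x

/-- A continuous map out of `BJ_{2^∞}` from compatible continuous maps out of the `BJ_{2^k}`. -/
theorem exists_desc_BJinf {T : Type} [TopologicalSpace T]
    (f : ∀ k, C(B.obj (GrpCat.of (J (2 ^ k))), T))
    (hf : ∀ k x, f (k + 1) (B.map (GrpCat.ofHom (expTwo k)) x) = f k x) :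
    ∃ g : C(B.obj Jinf, T), ∀ k x, g (B.map (toJinf k) x) = f k x := by
  obtain ⟨h⟩ := exists_isColimit_B sequenceJ
    (GrpCat.FilteredColimits.colimitCoconeIsColimit sequenceJ)
  let c : Cocone (sequenceJ ⋙ B) :=
    { pt := TopCat.of T
      ι := NatTrans.ofSequence (fun k => TopCat.ofHom (f k)) fun k => by
        have h' : sequenceJ.map (homOfLE (Nat.le_add_right k 1)) = GrpCat.ofHom (expTwo k) :=
          Functor.ofSequence_map_homOfLE_succ _ k
        rw [Functor.comp_map, h']
        ext x
        exact hf k x }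
  exact ⟨(h.desc c).hom, fun k x => ConcreteCategory.congr_hom (h.fac c k) x⟩

theorem exists_toJinf (y : B.obj Jinf) : ∃ k x, B.map (toJinf k) x = y := by
  obtain ⟨h⟩ := exists_isColimit_B sequenceJ
    (GrpCat.FilteredColimits.colimitCoconeIsColimit sequenceJ)
  exact Concrete.isColimit_exists_rep _ h y

attribute [local instance] MJ.instMonoid MJ.instContinuousMul

theorem MJ.exists_telescope_homeomorph :
    ∃ h : (colimit (telescope MJ idTwo) : TopCat.{0}) ≃ₜ ℤ × B.obj Jinf,
      ∀ (i k : ℕ) (x : B.obj (GrpCat.of (J (2 ^ k)))),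
        h (colimit.ι (telescope MJ idTwo) i (⟨k, x⟩ : MJ)) =
          ((k : ℤ) - (i : ℤ), B.map (toJinf k) x) := by
  let f : ℕ → C(MJ, ℤ × B.obj Jinf) := fun i =>
    ⟨fun y => ((y.1 : ℤ) - (i : ℤ), B.map (toJinf y.1) y.2), continuous_sigma fun k =>
      (continuous_const (y := (k : ℤ) - (i : ℤ))).prodMk (B.map (toJinf k)).hom.continuous⟩
  have hf : ∀ i x, f (i + 1) (x * idTwo) = f i x := by
    rintro i ⟨k, x⟩
    rw [MJ.mk_mul_idTwo]
    refine Prod.ext ?_ (toJinf_expTwo k x)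
    change ((k + 1 : ℕ) : ℤ) - ((i + 1 : ℕ) : ℤ) = (k : ℤ) - (i : ℤ)
    push_cast
    ring
  obtain ⟨inc, hinc⟩ : ∃ inc : ℕ → C(MJ, (colimit (telescope MJ idTwo) : TopCat.{0})), ∀ i x,
      inc i x = colimit.ι (telescope MJ idTwo) i x :=
    ⟨fun i => (colimit.ι (telescope MJ idTwo) i).hom, fun _ _ => rfl⟩
  let F : C((colimit (telescope MJ idTwo) : TopCat.{0}), ℤ × B.obj Jinf) :=
    (colimit.desc _ (telescopeCocone f hf)).hom
  have hF : ∀ i x, F (inc i x) = f i x := fun i x => (congrArg F (hinc i x)).trans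
    (ConcreteCategory.congr_hom (colimit.ι_desc (telescopeCocone f hf) i) x)
  have hι : ∀ (i j : ℕ) (x : MJ), inc (i + j) (x * idTwo ^ j) = inc i x := fun i j x => by
    rw [hinc, hinc]
    exact telescope_ι_pow (c := colimit.cocone (telescope MJ idTwo)) i j x
  have hdesc : ∀ d : ℤ, ∃ g : C(B.obj Jinf, (colimit (telescope MJ idTwo) : TopCat.{0})), ∀ k x,
      g (B.map (toJinf k) x) = inc (k + (-d).toNat) (⟨k, x⟩ * idTwo ^ d.toNat) := by
    intro d
    refine exists_desc_BJinf (fun k => ⟨fun x => inc (k + (-d).toNat)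
      (⟨k, x⟩ * idTwo ^ d.toNat), ?_⟩) fun k x => ?_
    · exact (inc (k + (-d).toNat)).continuous.comp
        ((continuous_mul_const (idTwo ^ d.toNat)).comp
          (continuous_sigmaMk (σ := fun k : ℕ => B.obj (GrpCat.of (J (2 ^ k)))) (i := k)))
    · have h := hι (k + (-d).toNat) 1 (⟨k, x⟩ * idTwo ^ d.toNat)
      rw [pow_one, mul_assoc, ← pow_succ, pow_succ', ← mul_assoc, MJ.mk_mul_idTwo] at h
      refine Eq.trans ?_ h
      have e : k + 1 + (-d).toNat = k + (-d).toNat + 1 := by omega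
      dsimp only [ContinuousMap.coe_mk]
      rw [e]
  choose g hg using hdesc
  refine ⟨{ toFun := F, invFun := fun y => g y.1 y.2, left_inv := ?_, right_inv := ?_,
            continuous_toFun := F.continuous, continuous_invFun := ?_ }, ?_⟩
  · intro z
    obtain ⟨i, x, rfl⟩ : ∃ i x, inc i x = z := by
      obtain ⟨i, x, h⟩ := Concrete.colimit_exists_rep (telescope MJ idTwo) z
      exact ⟨i, x, (hinc i x).trans h⟩
    obtain ⟨k, x⟩ := x
    have e : k + (-((k : ℤ) - (i : ℤ))).toNat = i + ((k : ℤ) - (i : ℤ)).toNat := by omega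
    dsimp only
    rw [hF]
    refine (hg ((k : ℤ) - (i : ℤ)) k x).trans ?_
    rw [e]
    exact hι i _ ⟨k, x⟩
  · rintro ⟨d, y⟩
    obtain ⟨k, x, rfl⟩ := exists_toJinf y
    dsimp only
    rw [hg, hF]
    have key : ∀ j : ℕ, ∃ x' : B.obj (GrpCat.of (J (2 ^ (k + j)))),
        (⟨k, x⟩ * idTwo ^ j : MJ) = ⟨k + j, x'⟩ ∧
          B.map (toJinf (k + j)) x' = B.map (toJinf k) x := by
      intro j
      induction j with
      | zero => exact ⟨x, by rw [pow_zero, mul_one]; rfl, rfl⟩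
      | succ j ih =>
        obtain ⟨x', h1, h2⟩ := ih
        refine ⟨B.map (GrpCat.ofHom (expTwo (k + j))) x', ?_, (toJinf_expTwo _ _).trans h2⟩
        rw [pow_succ, ← mul_assoc, h1, MJ.mk_mul_idTwo]
        rfl
    obtain ⟨x', h1, h2⟩ := key d.toNat
    rw [h1]
    refine Prod.ext ?_ h2
    change ((k + d.toNat : ℕ) : ℤ) - ((k + (-d).toNat : ℕ) : ℤ) = d
    omega
  · exact continuous_prod_of_discrete_left.2 fun d => (g d).continuous
  · exact fun i k x => (congrArg F (hinc i ⟨k, x⟩)).symm.trans (hF i ⟨k, x⟩)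

end QuasiBraid

theorem proposition6 :
    ∃ μ : ∀ k l : ℕ,
        QuasiBraid.J (2 ^ k) × QuasiBraid.J (2 ^ l) →* QuasiBraid.J (2 ^ (k + l)),
      -- the `μ k l` lift the wreath product morphisms of the symmetric groups
      (∀ (k l : ℕ) (a : QuasiBraid.J (2 ^ k)) (b : QuasiBraid.J (2 ^ l)),
        QuasiBraid.phi (2 ^ (k + l)) (μ k l (a, b)) =
          QuasiBraid.wreath k l (QuasiBraid.phi (2 ^ k) a, QuasiBraid.phi (2 ^ l) b)) ∧
      -- on the first factor, `μ k l` is the `l`-fold dyadic expansion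
      (∀ (k l : ℕ) (a : QuasiBraid.J (2 ^ k)), μ k l (a, 1) = QuasiBraid.expIter k l a) ∧
      -- on the second factor, `μ k l` copies a generator into each of the `2 ^ k` blocks
      (∀ k l a b : ℕ, a < b → b < 2 ^ l →
        μ k l (1, QuasiBraid.gen (2 ^ l) a b) =
          ((List.range (2 ^ k)).map fun i =>
            QuasiBraid.gen (2 ^ (k + l)) (i * 2 ^ l + a) (i * 2 ^ l + b)).prod) ∧
      -- the `Bμ k l` make `M_J` a topological monoid
      ∃ (_ : Monoid QuasiBraid.MJ) (_ : ContinuousMul QuasiBraid.MJ),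
        (∀ (k l : ℕ)
          (z : QuasiBraid.B.obj
            (GrpCat.of (QuasiBraid.J (2 ^ k) × QuasiBraid.J (2 ^ l)))),
          (⟨k, QuasiBraid.B.map (GrpCat.ofHom (MonoidHom.fst _ _)) z⟩ : QuasiBraid.MJ) *
              ⟨l, QuasiBraid.B.map (GrpCat.ofHom (MonoidHom.snd _ _)) z⟩ =
            ⟨k + l, QuasiBraid.B.map (GrpCat.ofHom (μ k l)) z⟩) ∧
        -- the inductive limit of its telescope is `ℤ × BJ_{2^∞}`
        ∃ h : (CategoryTheory.Limits.colimit
              (QuasiBraid.telescope QuasiBraid.MJ QuasiBraid.idTwo) : TopCat.{0}) ≃ₜ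
            ℤ × QuasiBraid.B.obj QuasiBraid.Jinf,
          ∀ (i k : ℕ) (x : QuasiBraid.B.obj (GrpCat.of (QuasiBraid.J (2 ^ k)))),
            h (CategoryTheory.Limits.colimit.ι
                (QuasiBraid.telescope QuasiBraid.MJ QuasiBraid.idTwo) i
                (⟨k, x⟩ : QuasiBraid.MJ)) =
              ((k : ℤ) - (i : ℤ), QuasiBraid.B.map (QuasiBraid.toJinf k) x) := by
  exact ⟨QuasiBraid.wreathJ, QuasiBraid.phi_wreathJ, QuasiBraid.wreathJ_one_right,
    fun k l a b _ hb => QuasiBraid.wreathJ_one_gen k l a b hb, QuasiBraid.MJ.instMonoid,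
    QuasiBraid.MJ.instContinuousMul, QuasiBraid.MJ.mk_fst_mul_mk_snd,
    QuasiBraid.MJ.exists_telescope_homeomorph⟩
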